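/- A rooted dipole is a loopless 2-cell embedding, in an orientable surface, of a graph with exactly two vertices, with a distinguished root edge and root vertex, up to orientation-preserving homeomorphism preserving the root. For a partition $\lambda$, let $\psi_\lambda$ be the number of rooted dipoles whose face-degree sequence is $2\lambda$. Consider rooted dipoles $D$ with, in addition, a secondary edge different from the root edge. At the root vertex let Region 1 be the region swept counterclockwise from the root edge to the secondary edge and Region 2 the complementary region; at the non-root vertex let Region 3 be the region swept counterclockwise from the root edge to the secondary edge and Region 4 the complementary region. Every other edge is an $a$-, $b$-, $c$- or $d$-edge according as its ends lie in Regions $(2,3)$, $(1,3)$, $(2,4)$ or $(1,4)$, and $D$ is an $(a,b,c,d)$-dipole if it has exactly $a$, $b$, $c$, $d$ edges of the respective types; write $\alpha(D),\beta(D),\gamma(D),\delta(D)$ for these numbers and $g(D)$ for the genus. Mark each corner at the root vertex with $\bullet$ if it lies in Region 1 and with $\circ$ if it lies in Region 2. Let $R(D)$ be the binary string read on a counterclockwise boundary walk of the root face, starting at the root corner (the corner following the root edge counterclockwise at the root vertex), let $\Lambda(D)$ be the multiset of cyclic binary strings read on the other faces, and put $f_{\Lambda(D)}=\prod_{(S)\in\Lambda(D)}f_{(S)}$.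 Let $$B=\sum_{D:\ \gamma(D)=\delta(D)=0}\frac{x^{\alpha(D)+1}}{(\alpha(D)+1)!}\,\frac{y^{\beta(D)}}{\beta(D)!}\,u^{2g(D)}\,g_{R(D)}\,f_{\Lambda(D)},\qquad B^{(2)}=[u^4]B,$$ and let $\langle B^{(2)}\rangle$ be obtained from $B^{(2)}$ by setting all indeterminates $g_R$ and $f_{(S)}$ to $1$. **Corollary.** For all integers $a\ge 0$ and $b\ge 1$, the number of $(a,b,0,0)$-dipoles on the double torus (the orientable surface of genus $2$) is $$\begin{aligned}\left[\frac{y^b}{b!}\frac{x^{a+1}}{(a+1)!}\right]\langle B^{(2)}\rangle ={}& 3(a+1)\binom{b+2}{5}+a(a+1)\binom{b+2}{4}+2(a+1)\binom{b+1}{5}+a(a+1)\binom{b+1}{4}\\&+\left(3\binom{b+2}{3}+(a-2)b\right)\psi_{(3,1^{a-2})}+\left(4\binom{b+1}{2}+(a-3)b\right)\psi_{(2^2,1^{a-3})},\end{aligned}$$ with the convention that $\psi_{(3,1^{a-2})}=0$ when $a<2$ and $\psi_{(2^2,1^{a-3})}=0$ when $a<3$. -/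

import Mathlib

open Equiv Finset
open scoped Nat

noncomputable section

/-! ### Rooted loopless dipoles in orientable surfaces -/

/-- A rooted loopless dipole in an oriented surface, with labelled edge set `E`, as a rotation
system. Every edge joins the root vertex to the non-root vertex, so the counterclockwise
circulation at each of the two vertices is a cyclic permutation of the whole edge set. -/
structure LabelledDipole (E : Type) where
  /-- the next edge counterclockwise around the root vertex -/
  rotRoot : Perm E
  /-- the next edge counterclockwise around the non-root vertex -/
  rotNonroot : Perm E
  rotRoot_cyclic : rotRoot.IsCycleOn Set.univ
  rotNonroot_cyclic : rotNonroot.IsCycleOn Set.univ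
  /-- the root edge -/
  root : E

/-- A dipole with a second distinguished edge, different from the root edge. -/
structure LabelledBirootedDipole (E : Type) extends LabelledDipole E where
  /-- the secondary edge -/
  secondary : E
  secondary_ne : secondary ≠ root

theorem isCycleOn_univ_conj {E : Type} {p : Perm E} (h : p.IsCycleOn Set.univ) (π : Perm E) :
    (π * p * π⁻¹).IsCycleOn Set.univ := by
  have h' := h.conj (g := π)
  rwa [Set.image_univ_of_surjective π.surjective] at h'

namespace LabelledDipole

variable {E : Type}

/-- Relabelling of the edges. -/
def relabel (D : LabelledDipole E) (π : Perm E) : LabelledDipole E where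
  rotRoot := π * D.rotRoot * π⁻¹
  rotNonroot := π * D.rotNonroot * π⁻¹
  rotRoot_cyclic := isCycleOn_univ_conj D.rotRoot_cyclic π
  rotNonroot_cyclic := isCycleOn_univ_conj D.rotNonroot_cyclic π
  root := π D.root

/-- Two labelled rooted dipoles are equivalent if they differ by a relabelling of the edges. -/
instance setoid : Setoid (LabelledDipole E) where
  r D D' := ∃ π : Perm E, D.relabel π = D'
  iseqv :=
    { refl := fun D => ⟨1, by cases D; simp [relabel]⟩
      symm := by
        rintro D _ ⟨π, rfl⟩
        exact ⟨π⁻¹, by cases D; simp [relabel, mul_assoc]⟩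
      trans := by
        rintro D _ _ ⟨π, rfl⟩ ⟨π', rfl⟩
        exact ⟨π' * π, by cases D; simp [relabel, mul_assoc]⟩ }

/-- The corners at the root vertex are indexed by the edges: corner `e` is the one between `e` and
the next edge counterclockwise. A counterclockwise boundary walk of a face (face on the left)
leaves corner `e` along `e`, turns at the non-root vertex into `rotNonroot⁻¹ e`, and so returns to
the root vertex at the corner `rotRoot⁻¹ (rotNonroot⁻¹ e)`. As it alternates between the two
vertices, the faces are the cycles of this permutation, and a cycle of length `k` is a face of
degree `2 * k`. -/
def faceStep (D : LabelledDipole E) : Perm E := D.rotRoot⁻¹ * D.rotNonroot⁻¹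

theorem faceStep_relabel (D : LabelledDipole E) (π : Perm E) :
    (D.relabel π).faceStep = π * D.faceStep * π⁻¹ := by
  simp [faceStep, relabel, mul_assoc]

variable [Fintype E] [DecidableEq E]

/-- The multiset `λ` for which `2λ` is the face-degree sequence. -/
def halfFaceDegrees (D : LabelledDipole E) : Multiset ℕ := D.faceStep.partition.parts

theorem halfFaceDegrees_relabel (D : LabelledDipole E) (π : Perm E) :
    (D.relabel π).halfFaceDegrees = D.halfFaceDegrees := by
  have h : IsConj D.faceStep (D.relabel π).faceStep :=
    isConj_iff.2 ⟨π, (D.faceStep_relabel π).symm⟩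
  rw [halfFaceDegrees, halfFaceDegrees, Equiv.Perm.partition_eq_of_isConj.1 h]

end LabelledDipole

/-- `orbitIndex p x y` is the least `i` with `p ^ i` sending `x` to `y`: the position of `y` in the
circulation `p` started at `x`. -/
def orbitIndex {E : Type} (p : Perm E) (x y : E) : ℕ := sInf {i : ℕ | (p ^ i) x = y}

theorem orbitIndex_conj {E : Type} (p π : Perm E) (x y : E) :
    orbitIndex (π * p * π⁻¹) (π x) (π y) = orbitIndex p x y := by
  simp [orbitIndex, conj_pow]

namespace LabelledBirootedDipole

variable {E : Type}

/-- Relabelling of the edges. -/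
def relabel (D : LabelledBirootedDipole E) (π : Perm E) : LabelledBirootedDipole E where
  toLabelledDipole := D.toLabelledDipole.relabel π
  secondary := π D.secondary
  secondary_ne := fun h => D.secondary_ne (π.injective h)

/-- Two labelled bi-rooted dipoles are equivalent if they differ by a relabelling of the edges. -/
instance setoid : Setoid (LabelledBirootedDipole E) where
  r D D' := ∃ π : Perm E, D.relabel π = D'
  iseqv :=
    { refl := fun D => ⟨1, by
        rcases D with ⟨D, s, h⟩; cases D; simp [relabel, LabelledDipole.relabel]⟩
      symm := by
        rintro D _ ⟨π, rfl⟩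
        exact ⟨π⁻¹, by
          rcases D with ⟨D, s, h⟩; cases D
          simp [relabel, LabelledDipole.relabel, mul_assoc]⟩
      trans := by
        rintro D _ _ ⟨π, rfl⟩ ⟨π', rfl⟩
        exact ⟨π' * π, by
          rcases D with ⟨D, s, h⟩; cases D
          simp [relabel, LabelledDipole.relabel, mul_assoc]⟩ }

/-- The edge `e` meets the interior of Region 1: at the root vertex it lies strictly between the
root edge and the secondary edge, counterclockwise from the root edge. -/
def InRegion1 (D : LabelledBirootedDipole E) (e : E) : Prop :=
  0 < orbitIndex D.rotRoot D.root e ∧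
    orbitIndex D.rotRoot D.root e < orbitIndex D.rotRoot D.root D.secondary

/-- The edge `e` meets the interior of Region 2: at the root vertex it lies strictly between the
secondary edge and the root edge, counterclockwise from the secondary edge. -/
def InRegion2 (D : LabelledBirootedDipole E) (e : E) : Prop :=
  orbitIndex D.rotRoot D.root D.secondary < orbitIndex D.rotRoot D.root e

/-- The edge `e` meets the interior of Region 3: at the non-root vertex it lies strictly between
the root edge and the secondary edge, counterclockwise from the root edge. -/
def InRegion3 (D : LabelledBirootedDipole E) (e : E) : Prop :=
  0 < orbitIndex D.rotNonroot D.root e ∧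
    orbitIndex D.rotNonroot D.root e < orbitIndex D.rotNonroot D.root D.secondary

/-- The edge `e` meets the interior of Region 4: at the non-root vertex it lies strictly between
the secondary edge and the root edge, counterclockwise from the secondary edge. -/
def InRegion4 (D : LabelledBirootedDipole E) (e : E) : Prop :=
  orbitIndex D.rotNonroot D.root D.secondary < orbitIndex D.rotNonroot D.root e

/-- The number of edges of each type: `a`-edges end in Regions 2 and 3. -/
def numA (D : LabelledBirootedDipole E) : ℕ := Nat.card {e : E // D.InRegion2 e ∧ D.InRegion3 e}
/-- `b`-edges end in Regions 1 and 3. -/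
def numB (D : LabelledBirootedDipole E) : ℕ := Nat.card {e : E // D.InRegion1 e ∧ D.InRegion3 e}
/-- `c`-edges end in Regions 2 and 4. -/
def numC (D : LabelledBirootedDipole E) : ℕ := Nat.card {e : E // D.InRegion2 e ∧ D.InRegion4 e}
/-- `d`-edges end in Regions 1 and 4. -/
def numD (D : LabelledBirootedDipole E) : ℕ := Nat.card {e : E // D.InRegion1 e ∧ D.InRegion4 e}

/-- The marking of the corners at the root vertex: corner `e` (between `e` and the next edge
counterclockwise) is marked with a black dot (`true`) if it is in Region 1 and with a white dot
(`false`) if it is in Region 2. -/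
def mark (D : LabelledBirootedDipole E) (e : E) : Bool :=
  decide (orbitIndex D.rotRoot D.root e < orbitIndex D.rotRoot D.root D.secondary)

/-- The binary string of the root face: the marks met on a counterclockwise boundary walk that
starts at the root corner. -/
def rootWord (D : LabelledBirootedDipole E) : List Bool :=
  (List.range (Function.minimalPeriod D.faceStep D.root)).map
    fun i => D.mark (D.faceStep^[i] D.root)

/-- The faces, as the cycles of `faceStep`. -/
abbrev Face (D : LabelledBirootedDipole E) : Type :=
  Quotient (Equiv.Perm.SameCycle.setoid D.faceStep)

/-- The cyclic binary string of the marks met on a counterclockwise boundary walk of the face that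
contains the corner `e`. -/
def cornerWord (D : LabelledBirootedDipole E) (e : E) : Cycle Bool :=
  (Function.periodicOrbit D.faceStep e).map D.mark

theorem cornerWord_sameCycle [Finite E] (D : LabelledBirootedDipole E) (e e' : E)
    (h : D.faceStep.SameCycle e e') : D.cornerWord e = D.cornerWord e' := by
  obtain ⟨n, -, rfl⟩ := h.exists_pow_eq'
  have hp : e ∈ Function.periodicPts D.faceStep :=
    D.faceStep.injective.mem_periodicPts e
  rw [cornerWord, cornerWord, Equiv.Perm.coe_pow, Function.periodicOrbit_apply_iterate_eq hp]

/-- The cyclic binary string of a face. -/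
def faceWord [Finite E] (D : LabelledBirootedDipole E) : D.Face → Cycle Bool :=
  Quotient.lift D.cornerWord fun _ _ h => D.cornerWord_sameCycle _ _ h

open Classical in
/-- The multiset of the cyclic binary strings of the non-root faces. -/
def nonrootWords [Fintype E] (D : LabelledBirootedDipole E) : Multiset (Cycle Bool) :=
  (univ.filter fun F : D.Face => F ≠ Quotient.mk _ D.root).val.map D.faceWord

end LabelledBirootedDipole

namespace LabelledBirootedDipole

variable {E : Type}

theorem inRegion1_relabel (D : LabelledBirootedDipole E) (π : Perm E) (e : E) :
    (D.relabel π).InRegion1 (π e) ↔ D.InRegion1 e := by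
  simp only [InRegion1, relabel, LabelledDipole.relabel, orbitIndex_conj]

theorem inRegion2_relabel (D : LabelledBirootedDipole E) (π : Perm E) (e : E) :
    (D.relabel π).InRegion2 (π e) ↔ D.InRegion2 e := by
  simp only [InRegion2, relabel, LabelledDipole.relabel, orbitIndex_conj]

theorem inRegion3_relabel (D : LabelledBirootedDipole E) (π : Perm E) (e : E) :
    (D.relabel π).InRegion3 (π e) ↔ D.InRegion3 e := by
  simp only [InRegion3, relabel, LabelledDipole.relabel, orbitIndex_conj]

theorem inRegion4_relabel (D : LabelledBirootedDipole E) (π : Perm E) (e : E) :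
    (D.relabel π).InRegion4 (π e) ↔ D.InRegion4 e := by
  simp only [InRegion4, relabel, LabelledDipole.relabel, orbitIndex_conj]

theorem numA_relabel (D : LabelledBirootedDipole E) (π : Perm E) :
    (D.relabel π).numA = D.numA :=
  (Nat.card_congr (π.subtypeEquiv fun e => by
    rw [inRegion2_relabel, inRegion3_relabel])).symm

theorem numB_relabel (D : LabelledBirootedDipole E) (π : Perm E) :
    (D.relabel π).numB = D.numB :=
  (Nat.card_congr (π.subtypeEquiv fun e => by
    rw [inRegion1_relabel, inRegion3_relabel])).symm

theorem numC_relabel (D : LabelledBirootedDipole E) (π : Perm E) :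
    (D.relabel π).numC = D.numC :=
  (Nat.card_congr (π.subtypeEquiv fun e => by
    rw [inRegion2_relabel, inRegion4_relabel])).symm

theorem numD_relabel (D : LabelledBirootedDipole E) (π : Perm E) :
    (D.relabel π).numD = D.numD :=
  (Nat.card_congr (π.subtypeEquiv fun e => by
    rw [inRegion1_relabel, inRegion4_relabel])).symm

theorem mark_relabel (D : LabelledBirootedDipole E) (π : Perm E) (e : E) :
    (D.relabel π).mark (π e) = D.mark e := by
  simp only [mark, relabel, LabelledDipole.relabel, orbitIndex_conj]

theorem iterate_relabel (D : LabelledBirootedDipole E) (π : Perm E) (e : E) (i : ℕ) :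
    (D.relabel π).faceStep^[i] (π e) = π (D.faceStep^[i] e) := by
  have h : (D.relabel π).faceStep = π * D.faceStep * π⁻¹ :=
    D.toLabelledDipole.faceStep_relabel π
  rw [← Equiv.Perm.coe_pow, ← Equiv.Perm.coe_pow, h]
  simp [conj_pow]

theorem minimalPeriod_relabel (D : LabelledBirootedDipole E) (π : Perm E) (e : E) :
    Function.minimalPeriod (D.relabel π).faceStep (π e) =
      Function.minimalPeriod D.faceStep e := by
  apply Function.minimalPeriod_eq_minimalPeriod_iff.2
  intro n
  rw [Function.IsPeriodicPt, Function.IsFixedPt, iterate_relabel, π.injective.eq_iff]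
  rfl

theorem rootWord_relabel (D : LabelledBirootedDipole E) (π : Perm E) :
    (D.relabel π).rootWord = D.rootWord := by
  have hr : (D.relabel π).root = π D.root := rfl
  simp only [rootWord, hr, minimalPeriod_relabel, iterate_relabel, mark_relabel]

theorem cornerWord_relabel (D : LabelledBirootedDipole E) (π : Perm E) (e : E) :
    (D.relabel π).cornerWord (π e) = D.cornerWord e := by
  simp only [cornerWord, Function.periodicOrbit, minimalPeriod_relabel, iterate_relabel,
    Cycle.map_coe, List.map_map, Function.comp_def, mark_relabel]

/-- The bijection of faces induced by a relabelling. -/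
def faceEquiv (D : LabelledBirootedDipole E) (π : Perm E) : D.Face ≃ (D.relabel π).Face :=
  Quotient.congr π fun e e' => by
    have h : (D.relabel π).faceStep = π * D.faceStep * π⁻¹ :=
      D.toLabelledDipole.faceStep_relabel π
    change D.faceStep.SameCycle e e' ↔ (D.relabel π).faceStep.SameCycle (π e) (π e')
    rw [h, Equiv.Perm.sameCycle_conj]
    simp

theorem nonrootWords_relabel [Fintype E] (D : LabelledBirootedDipole E) (π : Perm E) :
    (D.relabel π).nonrootWords = D.nonrootWords := by
  classical
  have h : (univ.filter fun F : (D.relabel π).Face => F ≠ Quotient.mk _ (D.relabel π).root) =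
      (univ.filter fun F : D.Face => F ≠ Quotient.mk _ D.root).map
        (D.faceEquiv π).toEmbedding := by
    ext F
    obtain ⟨F, rfl⟩ := (D.faceEquiv π).surjective F
    have hr : (Quotient.mk _ (D.relabel π).root : (D.relabel π).Face) =
      D.faceEquiv π (Quotient.mk _ D.root) := rfl
    simp [hr]
  unfold nonrootWords
  have h2 := congrArg (fun s => Multiset.map (D.relabel π).faceWord s.val) h
  simp only [Finset.map_val, Multiset.map_map] at h2
  convert h2 using 3 with F
  induction F using Quotient.inductionOn with
  | h e => exact (D.cornerWord_relabel π e).symm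

end LabelledBirootedDipole

/-- Rooted dipoles with `n` edges: labelled ones up to relabelling of the edges. -/
def RootedDipole (n : ℕ) : Type := Quotient (LabelledDipole.setoid (E := Fin n))

/-- The multiset `λ` for which the rooted dipole has face-degree sequence `2λ`. -/
def RootedDipole.halfFaceDegrees {n : ℕ} : RootedDipole n → Multiset ℕ :=
  Quotient.lift LabelledDipole.halfFaceDegrees (by
    rintro D _ ⟨π, rfl⟩; exact (D.halfFaceDegrees_relabel π).symm)

/-- `ψ_λ`, for a partition `λ` of `n`: the number of rooted dipoles (necessarily with `n` edges)
with face-degree sequence `2λ`. -/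
def psi (lam : Multiset ℕ) : ℕ :=
  Nat.card {D : RootedDipole lam.sum // D.halfFaceDegrees = lam}

/-- Rooted dipoles with a secondary edge and with `n` edges: labelled ones up to relabelling of the
edges. -/
def BirootedDipole (n : ℕ) : Type := Quotient (LabelledBirootedDipole.setoid (E := Fin n))

namespace BirootedDipole

variable {n : ℕ}

/-- The number of `a`-edges. -/
def alpha : BirootedDipole n → ℕ :=
  Quotient.lift LabelledBirootedDipole.numA (by
    rintro D _ ⟨π, rfl⟩; exact (D.numA_relabel π).symm)

/-- The number of `b`-edges. -/
def beta : BirootedDipole n → ℕ :=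
  Quotient.lift LabelledBirootedDipole.numB (by
    rintro D _ ⟨π, rfl⟩; exact (D.numB_relabel π).symm)

/-- The number of `c`-edges. -/
def gamma : BirootedDipole n → ℕ :=
  Quotient.lift LabelledBirootedDipole.numC (by
    rintro D _ ⟨π, rfl⟩; exact (D.numC_relabel π).symm)

/-- The number of `d`-edges. -/
def delta : BirootedDipole n → ℕ :=
  Quotient.lift LabelledBirootedDipole.numD (by
    rintro D _ ⟨π, rfl⟩; exact (D.numD_relabel π).symm)

/-- The multiset `λ` for which the bi-rooted dipole has face-degree sequence `2λ`. -/
def halfFaceDegrees : BirootedDipole n → Multiset ℕ :=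
  Quotient.lift (fun D => D.toLabelledDipole.halfFaceDegrees) (by
    rintro D _ ⟨π, rfl⟩; exact (D.toLabelledDipole.halfFaceDegrees_relabel π).symm)

/-- Twice the genus, from Euler's formula `2 - n + m = 2 - 2g` for `2` vertices, `n` edges and `m`
faces. (As `m ≤ n`, the truncated subtraction is the true one.) -/
def twiceGenus (D : BirootedDipole n) : ℕ := n - Multiset.card D.halfFaceDegrees

/-- The binary string of the root face. -/
def rootWord : BirootedDipole n → List Bool :=
  Quotient.lift LabelledBirootedDipole.rootWord (by
    rintro D _ ⟨π, rfl⟩; exact (D.rootWord_relabel π).symm)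

/-- The multiset of the cyclic binary strings of the non-root faces. -/
def nonrootWords : BirootedDipole n → Multiset (Cycle Bool) :=
  Quotient.lift LabelledBirootedDipole.nonrootWords (by
    rintro D _ ⟨π, rfl⟩; exact (D.nonrootWords_relabel π).symm)

end BirootedDipole

/-! ### The generating series -/

/-- Polynomials in the indeterminates `g_R` (`R` a binary string) and `f_(S)` (`(S)` a cyclic
binary string). -/
abbrev FaceRing : Type := MvPolynomial (List Bool ⊕ Cycle Bool) ℚ

/-- The monomial `g_{R(D)} f_{Λ(D)}`. -/
def faceMonomial {n : ℕ} (D : BirootedDipole n) : FaceRing :=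
  MvPolynomial.X (Sum.inl D.rootWord) *
    (D.nonrootWords.map fun S => MvPolynomial.X (Sum.inr S)).prod

/-- The exponent of `x ^ i * y ^ j`: the variable `x` is `0` and the variable `y` is `1`. -/
def xyExp (i j : ℕ) : Fin 2 →₀ ℕ := Finsupp.single 0 i + Finsupp.single 1 j

/-- The summand of the bi-rooted dipole `D`, as a power series in `u` over power series in
`x` and `y`:
`x ^ (α + 1) / (α + 1)! * y ^ β / β! * u ^ (2 g) * g_{R(D)} f_{Λ(D)}`. -/
def dipoleTerm {n : ℕ} (D : BirootedDipole n) : PowerSeries (MvPowerSeries (Fin 2) FaceRing) :=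
  PowerSeries.monomial D.twiceGenus
    (MvPowerSeries.monomial (xyExp (D.alpha + 1) D.beta)
      (((D.alpha + 1)! * D.beta ! : ℚ)⁻¹ • faceMonomial D))

/-- The `(a,b,0,0)`-dipole series `B`: the (coefficientwise finite) sum of `dipoleTerm D` over all
bi-rooted dipoles `D` with no `c`-edges and no `d`-edges. -/
def dipoleSeries : PowerSeries (MvPowerSeries (Fin 2) FaceRing) :=
  PowerSeries.mk fun k => fun m =>
    ∑ᶠ D : {D : Σ n, BirootedDipole n // D.2.gamma = 0 ∧ D.2.delta = 0},
      MvPowerSeries.coeff m (PowerSeries.coeff k (dipoleTerm D.1.2))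

/-- The genus `g` part `B^{(g)} = [u^{2g}] B`. -/
def genusSeries (g : ℕ) : MvPowerSeries (Fin 2) FaceRing :=
  PowerSeries.coeff (2 * g) dipoleSeries

/-- `⟨F⟩`: every indeterminate `g_R` and `f_(S)` is set to `1`. -/
def forgetFaces (F : MvPowerSeries (Fin 2) FaceRing) : MvPowerSeries (Fin 2) ℚ :=
  MvPowerSeries.map (MvPolynomial.eval fun _ => (1 : ℚ)) F

/-- `[x^i/i! y^j/j!] F`. -/
def expCoeff (i j : ℕ) (F : MvPowerSeries (Fin 2) ℚ) : ℚ :=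
  (i ! : ℚ) * (j ! : ℚ) * MvPowerSeries.coeff (xyExp i j) F

/-- The `(a,b,c,d)`-dipoles on the orientable surface of genus `g`. -/
def ABCDDipole (a b c d g : ℕ) : Type :=
  {D : Σ n, BirootedDipole n // D.2.alpha = a ∧ D.2.beta = b ∧ D.2.gamma = c ∧ D.2.delta = d ∧
    D.2.twiceGenus = 2 * g}

/-- `ψ_{(3,1^{a-2})}`, with the convention that it is `0` when `a < 2`. -/
def psiThree (a : ℕ) : ℕ :=
  if a < 2 then 0 else psi ({3} + Multiset.replicate (a - 2) 1)

/-- `ψ_{(2²,1^{a-3})}`, with the convention that it is `0` when `a < 3`. -/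
def psiTwoTwo (a : ℕ) : ℕ :=
  if a < 3 then 0 else psi ({2, 2} + Multiset.replicate (a - 3) 1)

end

/-! ### Numbers of cycles and first-return permutations -/

/-! Let `σ` be the circulation at the root vertex and `ρ` the face permutation. Then `σ * ρ` is the
inverse of the circulation at the other vertex, so dipoles correspond to pairs of full cycles `σ`,
`σ * ρ`. There are no `c`- or `d`-edges exactly when Region 4 contains no edge, that is, when `σ *
ρ` sends the root edge to the secondary edge. Rooted dipoles have no nontrivial automorphisms, so
`σ` and the root can be fixed; the number of `b`-edges then fixes the secondary edge, and only `ρ`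
is left to count (`nonempty_equiv_abcdDipole`).

Removing the root edge from the cycles of `ρ` leaves a permutation of `a + 1 + b` points with
equally many cycles. The condition on it is that it joins the two cycles of a standard permutation
of type `(a + 1, b)` into one (`card_faceStep_eq`). In genus 2 it has `a + 1 + b - 3` cycles, which
forces it to move 4, 5 or 6 points (`card_perm_eq_sum_joiningPerms`).

Fixed points do not matter for joining: deleting them replaces each permutation by its first-return
permutation, and the number of cycles of the product survives (`IsFirstReturn.mul`,
`IsFirstReturn.numCycles_eq`). Hence the count is a sum of products of binomial coefficients in `a +
1` and `b`, weighted by the numbers of joining permutations without fixed points on at most 6 points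
(`card_joiningPerms`). These weights are found by enumeration. The same method with a single cycle
gives `psiThree_eq` and `psiTwoTwo_eq`, and the formula becomes a binomial identity.

On the side of the series, setting the indeterminates to 1 turns each dipole into a term with
factorial denominators, which `expCoeff` cancels. -/

namespace Equiv.Perm

variable {K X : Type}

/-- The number of cycles of a permutation, fixed points included. -/
noncomputable def numCycles (f : Perm X) : ℕ := Nat.card (Quotient (SameCycle.setoid f))

/-- `g` is the permutation induced by `f` on the range of `ι` by first return. -/
structure IsFirstReturn (ι : K → X) (f : Perm X) (g : Perm K) : Prop where
  injective : Function.Injective ι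
  step : ∀ z, ∃ j, 0 < j ∧ (f ^ j) (ι z) = ι (g z) ∧
    ∀ i, 0 < i → i < j → (f ^ i) (ι z) ∉ Set.range ι
  meets : ∀ x, ∃ i : ℕ, (f ^ i) x ∈ Set.range ι

namespace IsFirstReturn

variable {ι : K → X} {f : Perm X} {g : Perm K}

theorem sameCycle_apply (h : IsFirstReturn ι f g) (z : K) : f.SameCycle (ι z) (ι (g z)) := by
  obtain ⟨j, -, hj, -⟩ := h.step z
  exact ⟨j, by simpa using hj⟩

/-- A path of `f` between points of the range decomposes into first returns: split off the first one
and induct on the length of the rest. -/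
theorem sameCycle_of_pow (h : IsFirstReturn ι f g) (t : ℕ) (z z' : K)
    (ht : (f ^ t) (ι z) = ι z') : g.SameCycle z z' := by
  induction t using Nat.strong_induction_on generalizing z with
  | h t ih =>
    rcases Nat.eq_zero_or_pos t with rfl | hpos
    · obtain rfl := h.injective (a₁ := z) (a₂ := z') (by simpa using ht)
      exact SameCycle.refl _ _
    · obtain ⟨j, hj0, hj, hn⟩ := h.step z
      have hjt : j ≤ t := by
        by_contra hlt
        exact hn t hpos (by omega) ⟨z', ht.symm⟩
      have := ih (t - j) (by omega) (g z) (by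
        rw [← hj, ← Perm.mul_apply, ← pow_add, Nat.sub_add_cancel hjt, ht])
      exact sameCycle_apply_left.1 this

theorem sameCycle_iff [Finite X] (h : IsFirstReturn ι f g) (z z' : K) :
    f.SameCycle (ι z) (ι z') ↔ g.SameCycle z z' := by
  have := Finite.of_injective ι h.injective
  constructor
  · intro hs
    obtain ⟨t, -, ht⟩ := hs.exists_pow_eq'
    exact h.sameCycle_of_pow t z z' ht
  · intro hs
    obtain ⟨t, -, rfl⟩ := hs.exists_pow_eq'
    clear hs
    induction t with
    | zero => exact SameCycle.refl _ _
    | succ t ih =>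
      rw [pow_succ', Perm.mul_apply]
      exact ih.trans (h.sameCycle_apply _)

/-- Each cycle of `f` visits the range, by `meets`, and its visits trace out exactly one cycle of
`g`. -/
theorem numCycles_eq [Finite X] (h : IsFirstReturn ι f g) : f.numCycles = g.numCycles := by
  let F : Quotient (SameCycle.setoid g) → Quotient (SameCycle.setoid f) :=
    Quotient.map' ι fun z z' hz => (h.sameCycle_iff z z').2 hz
  refine (Nat.card_eq_of_bijective F ⟨?_, ?_⟩).symm
  · rintro ⟨z⟩ ⟨z'⟩ hz
    exact Quotient.sound ((h.sameCycle_iff z z').1 (Quotient.exact hz))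
  · rintro ⟨x⟩
    obtain ⟨i, z, hz⟩ := h.meets x
    refine ⟨Quotient.mk _ z, Quotient.sound ?_⟩
    rw [hz]
    exact (show f.SameCycle x ((f ^ i) x) from ⟨i, by simp⟩).symm

/-- Composing with a permutation supported on the range of `ι` is compatible with first return. -/
theorem mul (h : IsFirstReturn ι f g) {ρ : Perm X} {ρ' : Perm K}
    (hρ : ∀ z, ρ (ι z) = ι (ρ' z)) (hfix : ∀ x, x ∉ Set.range ι → ρ x = x) :
    IsFirstReturn ι (f * ρ) (g * ρ') := by
  -- Outside the range `ρ` is the identity, so after the first step the path of `f * ρ` is a path of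
  -- `f` until the range is met again.
  have key : ∀ x y : X, ∀ j : ℕ, (f * ρ) x = y → (∀ i < j, (f ^ i) y ∉ Set.range ι) →
      ∀ i ≤ j, ((f * ρ) ^ (i + 1)) x = (f ^ i) y := by
    intro x y j hxy hn i
    induction i with
    | zero => intro _; simpa using hxy
    | succ i ih =>
      intro hi
      rw [pow_succ', Perm.mul_apply, ih (by omega), Perm.mul_apply, hfix _ (hn i (by omega)),
        pow_succ', Perm.mul_apply]
  refine ⟨h.injective, fun z => ?_, fun x => ?_⟩
  · obtain ⟨j, hj0, hj, hn⟩ := h.step (ρ' z)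
    have hk := key (ι z) (f (ι (ρ' z))) (j - 1) (by simp [hρ]) (fun i hi => by
      have := hn (i + 1) (by omega) (by omega)
      rwa [pow_succ, Perm.mul_apply] at this)
    refine ⟨j, hj0, ?_, fun i hi0 hij => ?_⟩
    · have := hk (j - 1) le_rfl
      rw [Nat.sub_add_cancel hj0] at this
      rw [this, ← Perm.mul_apply, ← pow_succ, Nat.sub_add_cancel hj0, hj]; rfl
    · have := hk (i - 1) (by omega)
      rw [Nat.sub_add_cancel hi0] at this
      rw [this, ← Perm.mul_apply, ← pow_succ, Nat.sub_add_cancel hi0]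
      exact hn i hi0 hij
  · classical
    have hex := h.meets x
    have hmin := fun i => Nat.find_min hex (m := i)
    refine ⟨Nat.find hex, ?_⟩
    have : ∀ i ≤ Nat.find hex, ((f * ρ) ^ i) x = (f ^ i) x := by
      intro i
      induction i with
      | zero => intro _; rfl
      | succ i ih =>
        intro hi
        rw [pow_succ', Perm.mul_apply, ih (by omega), Perm.mul_apply,
          hfix _ (hmin i (by omega)), pow_succ', Perm.mul_apply]
    rw [this _ le_rfl]
    exact Nat.find_spec hex

theorem sumCongr {K₁ K₂ X₁ X₂ : Type} {ι₁ : K₁ → X₁} {ι₂ : K₂ → X₂} {f₁ : Perm X₁} {f₂ : Perm X₂}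
    {g₁ : Perm K₁} {g₂ : Perm K₂} (h₁ : IsFirstReturn ι₁ f₁ g₁) (h₂ : IsFirstReturn ι₂ f₂ g₂) :
    IsFirstReturn (Sum.map ι₁ ι₂) (Perm.sumCongr f₁ f₂) (Perm.sumCongr g₁ g₂) := by
  have hp : ∀ i : ℕ, (Perm.sumCongr f₁ f₂) ^ i = Perm.sumCongr (f₁ ^ i) (f₂ ^ i) := by
    intro i
    induction i with
    | zero => simp
    | succ i ih => rw [pow_succ, ih, Perm.sumCongr_mul, ← pow_succ, ← pow_succ]
  refine ⟨h₁.injective.sumMap h₂.injective, ?_, ?_⟩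
  · rintro (z | z)
    · obtain ⟨j, hj0, hj, hn⟩ := h₁.step z
      refine ⟨j, hj0, by simp [hp, hj], fun i hi hij => ?_⟩
      have := hn i hi hij
      simpa [hp] using this
    · obtain ⟨j, hj0, hj, hn⟩ := h₂.step z
      refine ⟨j, hj0, by simp [hp, hj], fun i hi hij => ?_⟩
      have := hn i hi hij
      simpa [hp] using this
  · rintro (x | x)
    · obtain ⟨i, z, hz⟩ := h₁.meets x
      exact ⟨i, Sum.inl z, by simp [hp, hz]⟩
    · obtain ⟨i, z, hz⟩ := h₂.meets x
      exact ⟨i, Sum.inr z, by simp [hp, hz]⟩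

end IsFirstReturn

theorem val_finRotate_pow {m : ℕ} (i : ℕ) (x : Fin m) :
    (((finRotate m) ^ i) x).val = (x.val + i) % m := by
  have hm : 0 < m := x.pos
  obtain ⟨n, rfl⟩ : ∃ n, m = n + 1 := ⟨m - 1, by omega⟩
  induction i with
  | zero => simp [Nat.mod_eq_of_lt x.isLt]
  | succ i ih =>
    rw [pow_succ', Perm.mul_apply, finRotate_apply, Fin.val_add, ih, Fin.val_one', ← Nat.add_mod,
      add_assoc]

/-- In a rotation with some points deleted, the successor of a point is the next surviving one. The
condition `h0` excludes deleting a whole nonempty cycle. -/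
theorem isFirstReturn_finRotate {k m : ℕ} {ι : Fin k → Fin m} (hι : StrictMono ι)
    (h0 : 0 < m → 0 < k) : IsFirstReturn ι (finRotate m) (finRotate k) := by
  refine ⟨hι.injective, fun z => ?_, fun x => ?_⟩
  · obtain ⟨n, rfl⟩ : ∃ n, k = n + 1 := ⟨k - 1, by have := z.pos; omega⟩
    have hz := (ι z).isLt
    by_cases hlast : z = Fin.last n
    · subst hlast
      have hle : (ι 0).val ≤ (ι (Fin.last n)).val := hι.monotone (Fin.zero_le _)
      -- The last selected point returns by wrapping around to the first one.
      refine ⟨m - ι (Fin.last n) + ι 0, by omega, ?_, ?_⟩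
      · rw [finRotate_last]
        apply Fin.ext
        rw [val_finRotate_pow, show (ι (Fin.last n)).val + (m - ι (Fin.last n) + ι 0) =
          (ι 0).val + m by omega, Nat.add_mod_right, Nat.mod_eq_of_lt (ι 0).isLt]
      · rintro i hi0 hij ⟨y, hy⟩
        have hy := congrArg Fin.val hy
        rw [val_finRotate_pow] at hy
        have h1 : (ι 0).val ≤ (ι y).val := hι.monotone (Fin.zero_le _)
        have h2 : (ι y).val ≤ (ι (Fin.last n)).val := hι.monotone (Fin.le_last _)
        rcases lt_or_ge ((ι (Fin.last n)).val + i) m with hlt | hge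
        · rw [Nat.mod_eq_of_lt hlt] at hy
          omega
        · rw [Nat.mod_eq_sub_mod hge, Nat.mod_eq_of_lt (by omega)] at hy
          omega
    · have hv := coe_finRotate_of_ne_last hlast
      have hlt : (ι z).val < (ι (finRotate (n + 1) z)).val :=
        hι (Fin.lt_def.2 (by omega))
      have hm := (ι (finRotate (n + 1) z)).isLt
      refine ⟨ι (finRotate (n + 1) z) - ι z, by omega, ?_, ?_⟩
      · apply Fin.ext
        rw [val_finRotate_pow, Nat.mod_eq_of_lt (by omega)]
        omega
      · rintro i hi0 hij ⟨y, hy⟩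
        have hy := congrArg Fin.val hy
        rw [val_finRotate_pow, Nat.mod_eq_of_lt (by omega)] at hy
        have h1 : z < y := hι.lt_iff_lt.1 (Fin.lt_def.2 (by omega))
        have h2 : y < finRotate (n + 1) z := hι.lt_iff_lt.1 (Fin.lt_def.2 (by omega))
        rw [Fin.lt_def] at h1 h2
        omega
  · have hx := x.isLt
    have hk := h0 x.pos
    refine ⟨m - x + ι ⟨0, hk⟩, ⟨0, hk⟩, Fin.ext ?_⟩
    rw [val_finRotate_pow, show x.val + (m - x + ι ⟨0, hk⟩) = (ι ⟨0, hk⟩).val + m by omega,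
      Nat.add_mod_right, Nat.mod_eq_of_lt (ι ⟨0, hk⟩).isLt]

theorem isFirstReturn_of_semiconj (e : K ≃ X) (f : Perm X) (g : Perm K)
    (h : ∀ z, f (e z) = e (g z)) : IsFirstReturn e f g :=
  ⟨e.injective, fun z => ⟨1, one_pos, by simpa using h z, fun i hi hi' => by omega⟩,
    fun x => ⟨0, e.surjective _⟩⟩

/-- The left factor inserts `none` into the cycle of `x`, just before `x`; skipping it gives back
`f`. -/
theorem isFirstReturn_swap_none [DecidableEq X] (f : Perm X) (x : X) :
    IsFirstReturn some (swap none (some x) * optionCongr f) f := by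
  refine ⟨Option.some_injective _, fun z => ?_, fun y => ?_⟩
  · by_cases hz : f z = x
    · refine ⟨2, two_pos, by simp [pow_two, hz], fun i hi hi' => ?_⟩
      obtain rfl : i = 1 := by omega
      simp [hz]
    · refine ⟨1, one_pos, ?_, fun i hi hi' => by omega⟩
      simp only [pow_one, Perm.mul_apply, optionCongr_apply, Option.map_some]
      exact swap_apply_of_ne_of_ne (by simp) (by simpa using hz)
  · cases y with
    | none => exact ⟨1, x, by simp⟩
    | some y => exact ⟨0, y, by simp⟩

theorem numCycles_swap_none_mul [Finite X] [DecidableEq X] (f : Perm X) (x : X) :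
    (swap none (some x) * optionCongr f).numCycles = f.numCycles :=
  (isFirstReturn_swap_none f x).numCycles_eq

theorem isCycleOn_univ_iff [Finite X] [Nonempty X] (f : Perm X) :
    f.IsCycleOn _root_.Set.univ ↔ f.numCycles = 1 := by
  rw [numCycles, Nat.card_eq_one_iff_unique]
  constructor
  · intro h
    refine ⟨⟨?_⟩, ‹Nonempty X›.map (Quotient.mk _)⟩
    rintro ⟨x⟩ ⟨y⟩
    exact Quotient.sound (h.2 (Set.mem_univ x) (Set.mem_univ y))
  · rintro ⟨h, -⟩
    exact ⟨by simpa using f.bijective, fun x _ y _ => Quotient.exact (h.elim ⟦x⟧ ⟦y⟧)⟩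

/-! ### Cycle numbers in terms of cycle types and supports. -/

section Fintype

variable [Fintype X] [DecidableEq X]

theorem numCycles_eq_card_cycleType (f : Perm X) :
    f.numCycles = Multiset.card f.cycleType + (Fintype.card X - #f.support) := by
  have hne : ∀ c : f.cycleFactorsFinset, c.1.support.Nonempty := fun c =>
    (mem_cycleFactorsFinset_iff.1 c.2).1.nonempty_support
  have hmem : ∀ (c : f.cycleFactorsFinset) (x : X), x ∈ c.1.support → f.cycleOf x = c.1 :=
    fun c x hx => (cycle_is_cycleOf hx c.2).symm
  let F : f.cycleFactorsFinset ⊕ {x : X // x ∉ f.support} → Quotient (SameCycle.setoid f) :=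
    Sum.elim (fun c => Quotient.mk _ (hne c).choose) fun x => Quotient.mk _ x.1
  have hF : Function.Bijective F := by
    constructor
    · rintro (c | x) (d | y) h
      · have h' : f.SameCycle _ _ := Quotient.exact h
        have := h'.cycleOf_eq
        rw [hmem c _ (hne c).choose_spec, hmem d _ (hne d).choose_spec] at this
        rw [Subtype.ext this]
      · have h' : f.SameCycle _ _ := Quotient.exact h
        have h2 := mem_cycleFactorsFinset_support_le c.2 (hne c).choose_spec
        exact absurd (h'.mem_support_iff.1 h2) y.2
      · have h' : f.SameCycle _ _ := Quotient.exact h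
        have h2 := mem_cycleFactorsFinset_support_le d.2 (hne d).choose_spec
        exact absurd (h'.mem_support_iff.2 h2) x.2
      · have h' : f.SameCycle _ _ := Quotient.exact h
        have h2 : f x.1 = x.1 := notMem_support.1 x.2
        rw [Subtype.ext (h'.eq_of_left h2)]
    · rintro ⟨x⟩
      by_cases hx : x ∈ f.support
      · refine ⟨Sum.inl ⟨f.cycleOf x, cycleOf_mem_cycleFactorsFinset_iff.2 hx⟩,
          Quotient.sound ?_⟩
        have := (hne ⟨f.cycleOf x, cycleOf_mem_cycleFactorsFinset_iff.2 hx⟩).choose_spec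
        exact ((mem_support_cycleOf_iff.1 this).1).symm
      · exact ⟨Sum.inr ⟨x, hx⟩, rfl⟩
  rw [numCycles, ← Nat.card_eq_of_bijective F hF, Nat.card_sum, Nat.card_eq_fintype_card,
    Nat.card_eq_fintype_card, Fintype.card_coe, cycleType_def, Multiset.card_map,
    Fintype.card_subtype_compl, Fintype.card_coe]
  rfl

theorem card_parts_partition (f : Perm X) : Multiset.card f.partition.parts = f.numCycles := by
  rw [parts_partition, numCycles_eq_card_cycleType, Multiset.card_add, Multiset.card_replicate]

/-- Every added point is a new fixed point, hence a new cycle. -/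
theorem numCycles_extendDomain [Fintype K] [DecidableEq K] {p : X → Prop} [DecidablePred p]
    (f : Perm K) (e : K ≃ Subtype p) :
    (f.extendDomain e).numCycles + Fintype.card K = f.numCycles + Fintype.card X := by
  rw [numCycles_eq_card_cycleType, numCycles_eq_card_cycleType, cycleType_extendDomain,
    card_support_extend_domain]
  have h1 := card_le_univ f.support
  have h2 : Fintype.card K ≤ Fintype.card X := by
    rw [Fintype.card_congr e]; exact Fintype.card_subtype_le p
  omega

end Fintype

end Equiv.Perm

/-! ### Counting by supports -/

open Equiv.Perm

/-- Permutations `ρ` moving exactly `k` points, with `m₁ + m₂ - r` cycles, that join the two cycles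
of the standard permutation of type `(m₁, m₂)` to a single cycle. -/
noncomputable def joiningPerms (m₁ m₂ k r : ℕ) : Finset (Perm (Fin m₁ ⊕ Fin m₂)) :=
  {ρ | #ρ.support = k ∧ ρ.numCycles + r = m₁ + m₂ ∧
    (Perm.sumCongr (finRotate m₁) (finRotate m₂) * ρ).numCycles = 1}

/-- The parametrisation of `S₁ ⊔ S₂` by `Fin #S₁ ⊕ Fin #S₂` that is increasing on both parts. -/
noncomputable def disjSumEquiv {m₁ m₂ : ℕ} (S₁ : Finset (Fin m₁)) (S₂ : Finset (Fin m₂)) :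
    Fin #S₁ ⊕ Fin #S₂ ≃ {x // x ∈ S₁.disjSum S₂} :=
  Equiv.ofBijective
    (fun z => ⟨Sum.map (S₁.orderEmbOfFin rfl) (S₂.orderEmbOfFin rfl) z, by
      rcases z with z | z
      · exact inl_mem_disjSum.2 (S₁.orderEmbOfFin_mem rfl z)
      · exact inr_mem_disjSum.2 (S₂.orderEmbOfFin_mem rfl z)⟩)
    ⟨fun z z' h => ((S₁.orderEmbOfFin rfl).injective.sumMap (S₂.orderEmbOfFin rfl).injective)
        (congrArg Subtype.val h), by
      rintro ⟨x | x, hx⟩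
      · have hx' := inl_mem_disjSum.1 hx
        rw [← mem_coe, ← S₁.range_orderEmbOfFin rfl] at hx'
        obtain ⟨z, rfl⟩ := hx'
        exact ⟨Sum.inl z, rfl⟩
      · have hx' := inr_mem_disjSum.1 hx
        rw [← mem_coe, ← S₂.range_orderEmbOfFin rfl] at hx'
        obtain ⟨z, rfl⟩ := hx'
        exact ⟨Sum.inr z, rfl⟩⟩

theorem isFirstReturn_disjSum {m₁ m₂ : ℕ} (S₁ : Finset (Fin m₁)) (S₂ : Finset (Fin m₂))
    (h₁ : 0 < m₁ → 0 < #S₁) (h₂ : 0 < m₂ → 0 < #S₂) (ρ : Perm (Fin #S₁ ⊕ Fin #S₂)) :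
    IsFirstReturn (fun z => (disjSumEquiv S₁ S₂ z : Fin m₁ ⊕ Fin m₂))
      (Perm.sumCongr (finRotate m₁) (finRotate m₂) * ρ.extendDomain (disjSumEquiv S₁ S₂))
      (Perm.sumCongr (finRotate #S₁) (finRotate #S₂) * ρ) := by
  have h : IsFirstReturn (fun z => (disjSumEquiv S₁ S₂ z : Fin m₁ ⊕ Fin m₂))
      (Perm.sumCongr (finRotate m₁) (finRotate m₂))
      (Perm.sumCongr (finRotate #S₁) (finRotate #S₂)) :=
    (isFirstReturn_finRotate (S₁.orderEmbOfFin rfl).strictMono h₁).sumCongr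
      (isFirstReturn_finRotate (S₂.orderEmbOfFin rfl).strictMono h₂)
  refine h.mul (fun z => ?_) fun x hx => ?_
  · rw [extendDomain_apply_image]
  · refine extendDomain_apply_not_subtype _ _ fun hS => hx ?_
    exact ⟨(disjSumEquiv S₁ S₂).symm ⟨x, hS⟩, by simp⟩

/-- Extension by fixed points preserves the deficiency `r` and, by first return, the number of
cycles of the product. The full support on the small side matches the prescribed support on the
large side. -/
theorem extendDomain_mem_joiningPerms {m₁ m₂ : ℕ} (S₁ : Finset (Fin m₁)) (S₂ : Finset (Fin m₂))
    (r : ℕ) (h₁ : 0 < m₁ → 0 < #S₁) (h₂ : 0 < m₂ → 0 < #S₂) (ρ : Perm (Fin #S₁ ⊕ Fin #S₂)) :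
    (ρ.extendDomain (disjSumEquiv S₁ S₂) ∈ joiningPerms m₁ m₂ (#S₁ + #S₂) r ∧
      (ρ.extendDomain (disjSumEquiv S₁ S₂)).support = S₁.disjSum S₂) ↔
      ρ ∈ joiningPerms #S₁ #S₂ (#S₁ + #S₂) r := by
  have hn := numCycles_extendDomain ρ (disjSumEquiv S₁ S₂)
  simp only [Fintype.card_sum, Fintype.card_fin] at hn
  have hs : (ρ.extendDomain (disjSumEquiv S₁ S₂)).support ⊆ S₁.disjSum S₂ := by
    intro x hx
    by_contra hS
    exact mem_support.1 hx (extendDomain_apply_not_subtype _ _ hS)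
  simp only [joiningPerms, mem_filter, mem_univ, true_and, card_support_extend_domain,
    (isFirstReturn_disjSum S₁ S₂ h₁ h₂ ρ).numCycles_eq]
  constructor
  · rintro ⟨⟨h, h', h''⟩, -⟩
    exact ⟨h, by omega, h''⟩
  · rintro ⟨h, h', h''⟩
    refine ⟨⟨h, by omega, h''⟩, eq_of_subset_of_card_le hs ?_⟩
    rw [card_support_extend_domain, h, card_disjSum]

theorem extendDomain_permCongr_subtypePerm {K X : Type} {p : X → Prop} [DecidablePred p]
    (e : K ≃ Subtype p) (ρ : Perm X) (h : ∀ x, p (ρ x) ↔ p x) (hfix : ∀ x, ¬ p x → ρ x = x) :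
    (e.symm.permCongr (ρ.subtypePerm h)).extendDomain e = ρ := by
  ext x
  by_cases hx : p x
  · rw [extendDomain_apply_subtype _ _ hx]
    simp
  · rw [extendDomain_apply_not_subtype _ _ hx, hfix x hx]

theorem card_joiningPerms_support {m₁ m₂ : ℕ} (S₁ : Finset (Fin m₁)) (S₂ : Finset (Fin m₂))
    (r : ℕ) (h₁ : 0 < m₁ → 0 < #S₁) (h₂ : 0 < m₂ → 0 < #S₂) :
    #{ρ ∈ joiningPerms m₁ m₂ (#S₁ + #S₂) r | ρ.support = S₁.disjSum S₂} =
      #(joiningPerms #S₁ #S₂ (#S₁ + #S₂) r) := by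
  symm
  refine card_bij (fun ρ _ => ρ.extendDomain (disjSumEquiv S₁ S₂)) ?_ ?_ ?_
  · intro ρ hρ
    rw [mem_filter]
    exact (extendDomain_mem_joiningPerms S₁ S₂ r h₁ h₂ ρ).2 hρ
  · intro ρ _ ρ' _ h
    exact extendDomainHom_injective (disjSumEquiv S₁ S₂) h
  · intro ρ hρ
    rw [mem_filter] at hρ
    have hmem : ∀ x, ρ x ∈ S₁.disjSum S₂ ↔ x ∈ S₁.disjSum S₂ := fun x => by
      rw [← hρ.2]; exact apply_mem_support
    have he := extendDomain_permCongr_subtypePerm (disjSumEquiv S₁ S₂) ρ hmem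
      (fun x hx => by rwa [← hρ.2, notMem_support] at hx)
    exact ⟨_, (extendDomain_mem_joiningPerms S₁ S₂ r h₁ h₂ _).1 (by rw [he]; exact hρ), he⟩

theorem forall_of_numCycles_eq_one {X : Type} [Finite X] {f : Perm X} (hf : f.numCycles = 1)
    {P : X → Prop} (hP : ∀ x, P x → P (f x)) {x : X} (hx : P x) (y : X) : P y := by
  have : Nonempty X := ⟨x⟩
  have h : f.SameCycle x y := ((isCycleOn_univ_iff f).2 hf).2 trivial trivial
  obtain ⟨t, -, rfl⟩ := h.exists_pow_eq'
  clear h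
  induction t with
  | zero => exact hx
  | succ t ih => rw [pow_succ', Perm.mul_apply]; exact hP _ ih

/-- A nonempty cycle that misses the support of `ρ` stays an orbit of the product. By `h0` there is
a point on the other side, so the product has at least two cycles. -/
theorem joiningPerms_support_eq_empty {m₁ m₂ : ℕ} (S₁ : Finset (Fin m₁)) (S₂ : Finset (Fin m₂))
    (r : ℕ) (h0 : 0 < #S₁ + #S₂) (h : ¬ ((0 < m₁ → 0 < #S₁) ∧ (0 < m₂ → 0 < #S₂))) :
    #{ρ ∈ joiningPerms m₁ m₂ (#S₁ + #S₂) r | ρ.support = S₁.disjSum S₂} = 0 := by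
  rw [card_eq_zero, filter_eq_empty_iff]
  intro ρ hρ hS
  have hone := (mem_filter.1 hρ).2.2.2
  by_cases hm : 0 < m₁ → 0 < #S₁
  · have h2 : 0 < m₂ ∧ #S₂ = 0 := by
      constructor <;> by_contra hc <;> exact h ⟨hm, fun _ => by omega⟩
    obtain ⟨x, hx⟩ : S₁.Nonempty := card_pos.1 (by omega)
    have := forall_of_numCycles_eq_one hone (P := fun x => x.isRight = true) (by
      rintro (z | z) hz
      · simp at hz
      · have : ρ (Sum.inr z) = Sum.inr z := by
          rw [← notMem_support, hS, inr_mem_disjSum, card_eq_zero.1 h2.2]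
          exact notMem_empty _
        simp [this]) (x := Sum.inr ⟨0, h2.1⟩) rfl (Sum.inl x)
    simp at this
  · have h2 : 0 < m₁ ∧ #S₁ = 0 := by
      constructor <;> by_contra hc <;> exact hm fun _ => by omega
    obtain ⟨x, hx⟩ : S₂.Nonempty := card_pos.1 (by omega)
    have := forall_of_numCycles_eq_one hone (P := fun x => x.isLeft = true) (by
      rintro (z | z) hz
      · have : ρ (Sum.inl z) = Sum.inl z := by
          rw [← notMem_support, hS, inl_mem_disjSum, card_eq_zero.1 h2.2]
          exact notMem_empty _
        simp [this]
      · simp at hz) (x := Sum.inl ⟨0, h2.1⟩) rfl (Sum.inr x)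
    simp at this

/-- The number of `k`-subsets of an `m`-set that are nonempty if the `m`-set is. -/
def chooseMeeting (m k : ℕ) : ℕ := if 0 < m → 0 < k then m.choose k else 0

theorem card_joiningPerms (m₁ m₂ k r : ℕ) (hk : 0 < k) :
    #(joiningPerms m₁ m₂ k r) = ∑ p ∈ antidiagonal k,
      chooseMeeting m₁ p.1 * chooseMeeting m₂ p.2 * #(joiningPerms p.1 p.2 k r) := by
  let H : ℕ → ℕ → ℕ := fun i j =>
    if i + j = k then if (0 < m₁ → 0 < i) ∧ (0 < m₂ → 0 < j) then #(joiningPerms i j k r) else 0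
    else 0
  have hterm : ∀ (S₁ : Finset (Fin m₁)) (S₂ : Finset (Fin m₂)),
      #{ρ ∈ joiningPerms m₁ m₂ k r | ρ.support = S₁.disjSum S₂} = H #S₁ #S₂ := by
    intro S₁ S₂
    by_cases hs : #S₁ + #S₂ = k
    · subst hs
      simp only [H, if_true]
      split_ifs with h
      · exact card_joiningPerms_support S₁ S₂ r h.1 h.2
      · exact joiningPerms_support_eq_empty S₁ S₂ r hk h
    · simp only [H, if_neg hs]
      rw [card_eq_zero, filter_eq_empty_iff]
      intro ρ hρ hS
      have := (mem_filter.1 hρ).2.1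
      rw [hS, card_disjSum] at this
      exact hs this
  have hpow : ∀ (m : ℕ) (g : ℕ → ℕ),
      ∑ S : Finset (Fin m), g #S = ∑ i ∈ range (m + 1), m.choose i * g i := by
    intro m g
    rw [← powerset_univ, sum_powerset_apply_card]
    simp
  calc #(joiningPerms m₁ m₂ k r)
      = ∑ S : Finset (Fin m₁ ⊕ Fin m₂), #{ρ ∈ joiningPerms m₁ m₂ k r | ρ.support = S} :=
        card_eq_sum_card_fiberwise fun _ _ => mem_coe.2 (mem_univ _)
    _ = ∑ q : Finset (Fin m₁) × Finset (Fin m₂), H #q.1 #q.2 := by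
        refine Fintype.sum_equiv (Finset.sumEquiv (α := Fin m₁) (β := Fin m₂)).toEquiv _ _ ?_
        intro S
        obtain ⟨q, rfl⟩ := (Finset.sumEquiv (α := Fin m₁) (β := Fin m₂)).symm.surjective S
        rw [← hterm]
        simp only [RelIso.coe_fn_toEquiv, OrderIso.apply_symm_apply]
        congr!
    _ = ∑ i ∈ range (m₁ + 1), ∑ j ∈ range (m₂ + 1),
          m₁.choose i * (m₂.choose j * H i j) := by
        rw [Fintype.sum_prod_type]
        simp_rw [hpow m₂ (H _)]
        rw [hpow m₁ fun i => ∑ j ∈ range (m₂ + 1), m₂.choose j * H i j]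
        simp_rw [mul_sum]
    _ = ∑ p ∈ range (m₁ + 1) ×ˢ range (m₂ + 1), m₁.choose p.1 * (m₂.choose p.2 * H p.1 p.2) :=
        (sum_product' _ _ _).symm
    -- Passing through the union changes index sets: binomial coefficients vanish outside the
    -- rectangle, and `H` vanishes off the antidiagonal.
    _ = ∑ p ∈ range (m₁ + 1) ×ˢ range (m₂ + 1) ∪ antidiagonal k,
          m₁.choose p.1 * (m₂.choose p.2 * H p.1 p.2) := by
        refine sum_subset subset_union_left fun p _ hp => ?_
        rw [mem_product, mem_range, mem_range, not_and_or] at hp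
        rcases hp with hp | hp
        · rw [Nat.choose_eq_zero_of_lt (by omega), zero_mul]
        · rw [Nat.choose_eq_zero_of_lt (n := m₂) (by omega), zero_mul, mul_zero]
    _ = ∑ p ∈ antidiagonal k, m₁.choose p.1 * (m₂.choose p.2 * H p.1 p.2) := by
        refine (sum_subset subset_union_right fun p _ hp => ?_).symm
        rw [HasAntidiagonal.mem_antidiagonal] at hp
        simp [H, hp]
    _ = _ := by
        refine sum_congr rfl fun p hp => ?_
        rw [HasAntidiagonal.mem_antidiagonal] at hp
        simp only [H, hp, if_true, chooseMeeting]
        split_ifs <;> simp_all [mul_assoc]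

/-! ### Enumeration of the joining permutations of small degree -/

/-- The value at `x` of the `i`-th iterate of the map with list of values `l`. -/
def listIterate (l : List ℕ) : ℕ → ℕ → ℕ
  | 0, x => x
  | i + 1, x => listIterate l i (l.getD x 0)

/-- The number of cycles of the permutation with list of values `l`, counted by their least
elements. -/
def listNumCycles (l : List ℕ) : ℕ :=
  (List.range l.length).countP fun x =>
    (List.range l.length).all fun i => Nat.ble x (listIterate l i x)

/-- The test for joining permutations without fixed points, on lists of values. -/
def listJoining (k₁ k₂ r : ℕ) (l : List ℕ) : Bool :=
  (List.range l.length).all (fun x => ! Nat.beq (l.getD x 0) x) &&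
    Nat.beq (listNumCycles l + r) (k₁ + k₂) &&
    Nat.beq (listNumCycles (l.map fun x =>
      bif Nat.blt x k₁ then (x + 1) % k₁ else k₁ + (x - k₁ + 1) % k₂)) 1

/-- The list of values of a permutation of `Fin k`. -/
def valueList {k : ℕ} (f : Perm (Fin k)) : List ℕ := List.ofFn fun i => (f i).val

variable {k : ℕ}

theorem length_valueList (f : Perm (Fin k)) : (valueList f).length = k := List.length_ofFn

theorem getD_valueList (f : Perm (Fin k)) (x : Fin k) : (valueList f).getD x 0 = f x := by
  simp [valueList, List.getD_eq_getElem?_getD]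

theorem valueList_injective : Function.Injective (valueList : Perm (Fin k) → List ℕ) := by
  intro f g h
  ext x
  rw [← getD_valueList, h, getD_valueList]

theorem listIterate_valueList (f : Perm (Fin k)) (i : ℕ) (x : Fin k) :
    listIterate (valueList f) i x = (f ^ i) x := by
  induction i generalizing x with
  | zero => rfl
  | succ i ih => rw [listIterate, getD_valueList, ih, pow_succ, Perm.mul_apply]

/-- Each cycle has one least element. Exponents below `k` suffice since no cycle is longer than `k`.
-/
theorem numCycles_eq_card_min (f : Perm (Fin k)) :
    f.numCycles = #{x : Fin k | ∀ i < k, x ≤ (f ^ i) x} := by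
  have hmin : ∀ x : Fin k, (∀ i < k, x ≤ (f ^ i) x) → ∀ y, f.SameCycle x y → x ≤ y := by
    intro x hx y hxy
    by_cases hs : x ∈ f.support
    · obtain ⟨i, hi, rfl⟩ := hxy.exists_pow_eq_of_mem_support hs
      exact hx i (hi.trans_le ((card_le_univ _).trans (Fintype.card_fin k).le))
    · exact (hxy.eq_of_left (notMem_support.1 hs)).le
  rw [numCycles, ← Fintype.card_coe, ← Nat.card_eq_fintype_card]
  symm
  refine Nat.card_eq_of_bijective
    (fun x : {x // x ∈ ({x : Fin k | ∀ i < k, x ≤ (f ^ i) x} : Finset (Fin k))} =>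
      (Quotient.mk (SameCycle.setoid f) x.1)) ⟨?_, ?_⟩
  · rintro ⟨x, hx⟩ ⟨y, hy⟩ h
    have h : f.SameCycle x y := Quotient.exact h
    simp only [mem_filter, mem_univ, true_and] at hx hy
    exact Subtype.ext (le_antisymm (hmin x hx y h) (hmin y hy x h.symm))
  · rintro ⟨x⟩
    have hne : ({y : Fin k | f.SameCycle x y} : Finset (Fin k)).Nonempty :=
      ⟨x, by simp [SameCycle.refl]⟩
    obtain ⟨y, hy, hle⟩ := exists_min_image _ id hne
    simp only [mem_filter, mem_univ, true_and, id] at hy hle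
    refine ⟨⟨y, ?_⟩, Quotient.sound hy.symm⟩
    simp only [mem_filter, mem_univ, true_and]
    exact fun i _ => hle _ (hy.trans ⟨i, by simp⟩)

theorem listNumCycles_valueList (f : Perm (Fin k)) :
    listNumCycles (valueList f) = f.numCycles := by
  rw [numCycles_eq_card_min, listNumCycles, length_valueList, List.countP_eq_length_filter,
    ← Multiset.coe_card]
  have h1 : ((List.range k).filter fun x =>
      (List.range k).all fun i => Nat.ble x (listIterate (valueList f) i x)) =
      ((List.finRange k).filter fun x : Fin k => ∀ i < k, x ≤ (f ^ i) x).map Fin.val := by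
    nth_rewrite 2 [← List.map_coe_finRange_eq_range]
    rw [List.filter_map]
    congr 1
    refine List.filter_congr fun x _ => ?_
    rw [Bool.eq_iff_iff]
    simp only [Function.comp_apply, List.all_eq_true, List.mem_range, Nat.ble_eq,
      listIterate_valueList, decide_eq_true_eq, Fin.le_def]
  rw [h1, ← Multiset.map_coe, Multiset.card_map]
  rfl

theorem valueList_mem_permutations (l : List ℕ) :
    l ∈ (List.range k).permutations' ↔ ∃ f : Perm (Fin k), valueList f = l := by
  rw [List.mem_permutations']
  constructor
  · intro h
    have hlen : l.length = k := by simpa using h.length_eq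
    have hlt : ∀ i : Fin k, l[i.val]'(by omega) < k := fun i => by
      have := h.subset (List.getElem_mem (l := l) (n := i.val) (by omega))
      simpa using this
    have hnd : l.Nodup := h.nodup_iff.2 List.nodup_range
    let F : Fin k → Fin k := fun i => ⟨l[i.val]'(by omega), hlt i⟩
    have hF : Function.Injective F := fun i j hij => by
      have := congrArg Fin.val hij
      exact Fin.ext ((hnd.getElem_inj_iff).1 this)
    refine ⟨Equiv.ofBijective F (Finite.injective_iff_bijective.1 hF), ?_⟩
    apply List.ext_getElem
    · rw [length_valueList, hlen]
    · intro i h1 h2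
      simp [valueList, F]
  · rintro ⟨f, rfl⟩
    refine (List.perm_ext_iff_of_nodup ?_ List.nodup_range).2 fun x => ?_
    · exact List.nodup_ofFn.2 (Fin.val_injective.comp f.injective)
    · simp only [valueList, List.mem_ofFn, List.mem_range]
      constructor
      · rintro ⟨i, rfl⟩; exact (f i).isLt
      · intro hx; exact ⟨f.symm ⟨x, hx⟩, by simp⟩

theorem card_filter_valueList (P : List ℕ → Bool) :
    #{f : Perm (Fin k) | P (valueList f) = true} =
      ((List.range k).permutations'.filter P).length := by
  have hnd : (List.range k).permutations'.Nodup :=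
    (List.permutations_perm_permutations' _).nodup_iff.1 (List.nodup_permutations _ List.nodup_range)
  rw [← card_image_of_injective _ valueList_injective, ← List.toFinset_card_of_nodup (hnd.filter _)]
  congr 1
  ext l
  simp only [mem_image, mem_filter, mem_univ, true_and, List.mem_toFinset, List.mem_filter,
    valueList_mem_permutations]
  constructor
  · rintro ⟨f, hf, rfl⟩; exact ⟨⟨f, rfl⟩, hf⟩
  · rintro ⟨⟨f, rfl⟩, hf⟩; exact ⟨f, hf, rfl⟩

theorem numCycles_permCongr {X Y : Type} [Finite Y] (e : X ≃ Y) (f : Perm X) :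
    (e.permCongr f).numCycles = f.numCycles :=
  (isFirstReturn_of_semiconj e (e.permCongr f) f fun z => by simp).numCycles_eq

theorem val_finSumFinEquiv_sumCongr {k₁ k₂ : ℕ} (z : Fin k₁ ⊕ Fin k₂) :
    (finSumFinEquiv (Perm.sumCongr (finRotate k₁) (finRotate k₂) z)).val =
      bif Nat.blt (finSumFinEquiv z) k₁ then ((finSumFinEquiv z).val + 1) % k₁
      else k₁ + ((finSumFinEquiv z).val - k₁ + 1) % k₂ := by
  rcases z with z | z
  · have := val_finRotate_pow 1 z
    have h : Nat.blt z.val k₁ = true := by rw [Nat.blt_eq]; exact z.isLt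
    simp only [pow_one] at this
    simp [h, this, -finRotate_apply]
  · have := val_finRotate_pow 1 z
    have h : Nat.blt (k₁ + z.val) k₁ = false := by
      rw [Bool.eq_false_iff, Ne, Nat.blt_eq]; omega
    simp only [pow_one] at this
    simp [h, this, -finRotate_apply]

/-- This moves the count to lists of naturals and Boolean tests, a form in which the kernel can
evaluate it. -/
theorem card_joiningPerms_eq_length (k₁ k₂ r : ℕ) :
    #(joiningPerms k₁ k₂ (k₁ + k₂) r) =
      ((List.range (k₁ + k₂)).permutations'.filter (listJoining k₁ k₂ r)).length := by
  rw [← card_filter_valueList]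
  refine card_equiv finSumFinEquiv.permCongr fun ρ => ?_
  simp only [joiningPerms, mem_filter, mem_univ, true_and]
  set τ := (finSumFinEquiv (m := k₁) (n := k₂)).permCongr ρ with hτ
  have hmap : (valueList τ).map (fun x =>
      bif Nat.blt x k₁ then (x + 1) % k₁ else k₁ + (x - k₁ + 1) % k₂) =
      valueList (finSumFinEquiv.permCongr
        (Perm.sumCongr (finRotate k₁) (finRotate k₂) * ρ)) := by
    rw [valueList, valueList, List.map_ofFn]
    congr 1
    ext i
    obtain ⟨z, rfl⟩ := finSumFinEquiv.surjective i
    simp only [hτ, Function.comp_apply, permCongr_apply, symm_apply_apply, Perm.mul_apply]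
    exact (val_finSumFinEquiv_sumCongr (ρ z)).symm
  have hsupp : #ρ.support = k₁ + k₂ ↔ ∀ x : Fin (k₁ + k₂), τ x ≠ x := by
    have : #ρ.support = k₁ + k₂ ↔ ρ.support = univ := by
      rw [← card_eq_iff_eq_univ]; simp
    rw [this, eq_univ_iff_forall]
    constructor
    · intro h x
      obtain ⟨z, rfl⟩ := finSumFinEquiv.surjective x
      simpa [hτ] using h z
    · intro h z
      simpa [hτ] using h (finSumFinEquiv z)
  rw [listJoining, hmap, Bool.and_eq_true, Bool.and_eq_true, Nat.beq_eq, Nat.beq_eq,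
    listNumCycles_valueList, listNumCycles_valueList, numCycles_permCongr,
    numCycles_permCongr, length_valueList, hsupp, and_assoc]
  refine and_congr_left fun _ => ?_
  rw [List.all_eq_true]
  constructor
  · intro h x hx
    have := h ⟨x, List.mem_range.1 hx⟩
    have hg := getD_valueList τ ⟨x, List.mem_range.1 hx⟩
    simp only at hg
    rw [hg, Bool.not_eq_true', Bool.eq_false_iff, Ne, Nat.beq_eq]
    exact fun hc => this (Fin.ext hc)
  · intro h x hx
    have := h x (List.mem_range.2 x.isLt)
    rw [getD_valueList, hx] at this
    simp at this

/-- The values with second length 0 serve the two `ψ` numbers; those with `r = 3` are the weights in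
genus 2. -/
theorem card_joiningPerms_three_zero : #(joiningPerms 3 0 3 2) = 1 :=
  (card_joiningPerms_eq_length 3 0 2).trans (by decide +kernel)

theorem card_joiningPerms_four_zero : #(joiningPerms 4 0 4 2) = 1 :=
  (card_joiningPerms_eq_length 4 0 2).trans (by decide +kernel)

theorem card_joiningPerms_one_three : #(joiningPerms 1 3 4 3) = 3 :=
  (card_joiningPerms_eq_length 1 3 3).trans (by decide +kernel)

theorem card_joiningPerms_two_two : #(joiningPerms 2 2 4 3) = 2 :=
  (card_joiningPerms_eq_length 2 2 3).trans (by decide +kernel)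

theorem card_joiningPerms_three_one : #(joiningPerms 3 1 4 3) = 3 :=
  (card_joiningPerms_eq_length 3 1 3).trans (by decide +kernel)

theorem card_joiningPerms_one_four : #(joiningPerms 1 4 5 3) = 8 :=
  (card_joiningPerms_eq_length 1 4 3).trans (by decide +kernel)

theorem card_joiningPerms_two_three : #(joiningPerms 2 3 5 3) = 6 :=
  (card_joiningPerms_eq_length 2 3 3).trans (by decide +kernel)

theorem card_joiningPerms_three_two : #(joiningPerms 3 2 5 3) = 6 :=
  (card_joiningPerms_eq_length 3 2 3).trans (by decide +kernel)

theorem card_joiningPerms_four_one : #(joiningPerms 4 1 5 3) = 8 :=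
  (card_joiningPerms_eq_length 4 1 3).trans (by decide +kernel)

theorem card_joiningPerms_one_five : #(joiningPerms 1 5 6 3) = 5 :=
  (card_joiningPerms_eq_length 1 5 3).trans (by decide +kernel)

theorem card_joiningPerms_two_four : #(joiningPerms 2 4 6 3) = 4 :=
  (card_joiningPerms_eq_length 2 4 3).trans (by decide +kernel)

theorem card_joiningPerms_three_three : #(joiningPerms 3 3 6 3) = 3 :=
  (card_joiningPerms_eq_length 3 3 3).trans (by decide +kernel)

theorem card_joiningPerms_four_two : #(joiningPerms 4 2 6 3) = 4 :=
  (card_joiningPerms_eq_length 4 2 3).trans (by decide +kernel)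

theorem card_joiningPerms_five_one : #(joiningPerms 5 1 6 3) = 5 :=
  (card_joiningPerms_eq_length 5 1 3).trans (by decide +kernel)

/-! ### Rooted dipoles -/

/-! ### Positions along a full cycle. -/

section OrbitIndex

variable {E : Type} [Fintype E] {p q : Perm E}

theorem orbitIndex_spec (hp : p.IsCycleOn Set.univ) (r e : E) :
    orbitIndex p r e < Fintype.card E ∧ (p ^ orbitIndex p r e) r = e := by
  have hp' : p.IsCycleOn ((univ : Finset E) : Set E) := by simpa using hp
  obtain ⟨i, hi, hie⟩ := hp'.exists_pow_eq (mem_univ r) (mem_univ e)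
  exact ⟨(Nat.sInf_le (s := {i | (p ^ i) r = e}) hie).trans_lt hi,
    Nat.sInf_mem (s := {i | (p ^ i) r = e}) ⟨i, hie⟩⟩

theorem pow_apply_eq_iff_modEq (hp : p.IsCycleOn Set.univ) (r : E) (i j : ℕ) :
    (p ^ i) r = (p ^ j) r ↔ i ≡ j [MOD Fintype.card E] := by
  have hp' : p.IsCycleOn ((univ : Finset E) : Set E) := by simpa using hp
  exact hp'.pow_apply_eq_pow_apply (mem_univ r)

theorem orbitIndex_pow (hp : p.IsCycleOn Set.univ) (r : E) {i : ℕ} (hi : i < Fintype.card E) :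
    orbitIndex p r ((p ^ i) r) = i := by
  obtain ⟨h1, h2⟩ := orbitIndex_spec hp r ((p ^ i) r)
  rw [pow_apply_eq_iff_modEq hp] at h2
  exact h2.eq_of_lt_of_lt h1 hi

theorem orbitIndex_injective (hp : p.IsCycleOn Set.univ) (r : E) :
    Function.Injective (orbitIndex p r) := fun e e' h => by
  rw [← (orbitIndex_spec hp r e).2, h, (orbitIndex_spec hp r e').2]

theorem orbitIndex_self (hp : p.IsCycleOn Set.univ) (r : E) : orbitIndex p r r = 0 :=
  orbitIndex_pow hp r (i := 0) (Fintype.card_pos_iff.2 ⟨r⟩)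

/-- The numbering of `E` by the circulation `p` started at `r`. -/
noncomputable def orbitEquiv (hp : p.IsCycleOn Set.univ) (r : E) : E ≃ Fin (Fintype.card E) where
  toFun e := ⟨orbitIndex p r e, (orbitIndex_spec hp r e).1⟩
  invFun i := (p ^ i.val) r
  left_inv e := (orbitIndex_spec hp r e).2
  right_inv i := Fin.ext (orbitIndex_pow hp r i.isLt)

/-- The bijection that carries the circulation `p` started at `r` to the circulation `q` started
at `s`. -/
noncomputable def orbitPerm (hp : p.IsCycleOn Set.univ) (hq : q.IsCycleOn Set.univ) (r s : E) : Perm E :=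
  (orbitEquiv hp r).trans (orbitEquiv hq s).symm

variable (hp : p.IsCycleOn Set.univ) (hq : q.IsCycleOn Set.univ) (r s : E)

theorem orbitPerm_pow (i : ℕ) : orbitPerm hp hq r s ((p ^ i) r) = (q ^ i) s := by
  change (q ^ orbitIndex p r ((p ^ i) r)) s = (q ^ i) s
  rw [pow_apply_eq_iff_modEq hq, ← pow_apply_eq_iff_modEq hp r, (orbitIndex_spec hp r _).2]

theorem orbitPerm_root : orbitPerm hp hq r s r = s := orbitPerm_pow hp hq r s 0

theorem orbitPerm_conj :
    orbitPerm hp hq r s * p * (orbitPerm hp hq r s)⁻¹ = q := by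
  rw [mul_inv_eq_iff_eq_mul]
  ext e
  obtain ⟨i, rfl⟩ : ∃ i : ℕ, (p ^ i) r = e := ⟨_, (orbitIndex_spec hp r e).2⟩
  rw [Perm.mul_apply, Perm.mul_apply, ← Perm.mul_apply p, ← pow_succ', orbitPerm_pow,
    orbitPerm_pow, pow_succ', Perm.mul_apply]

/-- The centraliser of a transitive permutation acts freely. Hence rooted dipoles are rigid, and
fixing the root circulation and the root leaves one representative per class. -/
theorem eq_one_of_conj_eq (hp : p.IsCycleOn Set.univ) (r : E) {π : Perm E} (hπ : π * p * π⁻¹ = p) (hr : π r = r) : π = 1 := by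
  rw [mul_inv_eq_iff_eq_mul] at hπ
  ext e
  obtain ⟨i, rfl⟩ : ∃ i : ℕ, (p ^ i) r = e := ⟨_, (orbitIndex_spec hp r e).2⟩
  have : π * p ^ i = p ^ i * π := (show Commute π p from hπ).pow_right i
  rw [← Perm.mul_apply, this, Perm.mul_apply, hr]
  rfl

end OrbitIndex

theorem LabelledDipole.eq_of {E : Type} {D D' : LabelledDipole E} (h₁ : D.rotRoot = D'.rotRoot)
    (h₂ : D.rotNonroot = D'.rotNonroot) (h₃ : D.root = D'.root) : D = D' := by
  cases D; cases D'; simp_all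

/-- The dipole with circulation `σ` at the root vertex, root edge `r` and face permutation `ρ`. -/
def LabelledDipole.ofFaceStep {E : Type} {σ ρ : Perm E} (hσ : σ.IsCycleOn Set.univ)
    (hρ : (σ * ρ).IsCycleOn Set.univ) (r : E) : LabelledDipole E where
  rotRoot := σ
  rotNonroot := (σ * ρ)⁻¹
  rotRoot_cyclic := hσ
  rotNonroot_cyclic := isCycleOn_inv.2 hρ
  root := r

theorem LabelledDipole.faceStep_ofFaceStep {E : Type} {σ ρ : Perm E} (hσ : σ.IsCycleOn Set.univ)
    (hρ : (σ * ρ).IsCycleOn Set.univ) (r : E) : (ofFaceStep hσ hρ r).faceStep = ρ := by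
  simp [ofFaceStep, faceStep]

theorem LabelledDipole.rotRoot_mul_faceStep {E : Type} (D : LabelledDipole E) :
    D.rotRoot * D.faceStep = D.rotNonroot⁻¹ := by
  simp [faceStep]

theorem LabelledDipole.ofFaceStep_faceStep {E : Type} (D : LabelledDipole E)
    (h : (D.rotRoot * D.faceStep).IsCycleOn Set.univ) :
    ofFaceStep D.rotRoot_cyclic h D.root = D :=
  eq_of rfl (by simp [ofFaceStep, rotRoot_mul_faceStep]) rfl

theorem isCycleOn_rotRoot_mul_faceStep {E : Type} (D : LabelledDipole E) :
    (D.rotRoot * D.faceStep).IsCycleOn Set.univ := by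
  rw [D.rotRoot_mul_faceStep]; exact isCycleOn_inv.2 D.rotNonroot_cyclic

theorem card_rootedDipole {n : ℕ} {σ : Perm (Fin n)} (hσ : σ.IsCycleOn Set.univ) (r : Fin n)
    (lam : Multiset ℕ) :
    Nat.card {D : RootedDipole n // D.halfFaceDegrees = lam} =
      Nat.card {ρ : Perm (Fin n) // ρ.partition.parts = lam ∧ (σ * ρ).IsCycleOn Set.univ} := by
  symm
  have hdeg : ∀ (ρ : Perm (Fin n)) (hρ : (σ * ρ).IsCycleOn Set.univ),
      (LabelledDipole.ofFaceStep hσ hρ r).halfFaceDegrees = ρ.partition.parts := fun ρ hρ => by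
    rw [LabelledDipole.halfFaceDegrees, LabelledDipole.faceStep_ofFaceStep]
  refine Nat.card_eq_of_bijective
    (fun ρ => ⟨Quotient.mk _ (LabelledDipole.ofFaceStep hσ ρ.2.2 r),
      (hdeg _ _).trans ρ.2.1⟩) ⟨?_, ?_⟩
  · rintro ⟨ρ, hρ⟩ ⟨ρ', hρ'⟩ h
    obtain ⟨π, hπ⟩ := Quotient.exact (congrArg Subtype.val h)
    have hπ1 : π = 1 := eq_one_of_conj_eq hσ r (congrArg LabelledDipole.rotRoot hπ)
      (congrArg LabelledDipole.root hπ)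
    have := congrArg LabelledDipole.faceStep hπ
    rw [LabelledDipole.faceStep_relabel, LabelledDipole.faceStep_ofFaceStep,
      LabelledDipole.faceStep_ofFaceStep, hπ1] at this
    exact Subtype.ext (by simpa using this)
  · rintro ⟨⟨D⟩, hD⟩
    have hD : D.halfFaceDegrees = lam := hD
    let π := orbitPerm D.rotRoot_cyclic hσ D.root r
    have h₁ : (D.relabel π).rotRoot = σ := orbitPerm_conj _ _ _ _
    have h₃ : (D.relabel π).root = r := orbitPerm_root _ _ _ _
    have hc := isCycleOn_rotRoot_mul_faceStep (D.relabel π)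
    have he := (D.relabel π).ofFaceStep_faceStep hc
    have hc' := hc
    rw [h₁] at hc'
    refine ⟨⟨(D.relabel π).faceStep, ?_, hc'⟩, Subtype.ext ?_⟩
    · exact (D.halfFaceDegrees_relabel π).trans hD
    · refine (Quotient.sound (s := LabelledDipole.setoid) (a := D) ⟨π, ?_⟩).symm
      refine LabelledDipole.eq_of h₁ ?_ h₃
      have := (congrArg LabelledDipole.rotNonroot he).symm
      simpa [LabelledDipole.ofFaceStep, h₁] using this

theorem isCycleOn_finRotate {n : ℕ} : (finRotate n).IsCycleOn Set.univ := by
  refine ⟨by simpa using (finRotate n).bijective, fun x _ y _ => ?_⟩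
  refine ⟨((n - x + y : ℕ) : ℤ), Fin.ext ?_⟩
  have hx := x.isLt
  rw [zpow_natCast, val_finRotate_pow, show x.val + (n - x + y) = y.val + n by omega,
    Nat.add_mod_right, Nat.mod_eq_of_lt y.isLt]

/-! ### The two `ψ` numbers as binomial coefficients. -/

theorem parts_eq_iff_support_three {X : Type} [Fintype X] [DecidableEq X] {n : ℕ}
    (hn : Fintype.card X = n + 3) (f : Perm X) :
    f.partition.parts = {3} + Multiset.replicate n 1 ↔
      #f.support = 3 ∧ f.numCycles + 2 = n + 3 := by
  have hle : #f.support ≤ Fintype.card X := card_le_univ _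
  rw [numCycles_eq_card_cycleType]
  constructor
  · intro h
    have hc : f.cycleType = {3} := by
      rw [← filter_parts_partition_eq_cycleType, h, Multiset.filter_add,
        Multiset.filter_eq_nil (s := Multiset.replicate n 1) |>.2 fun x hx => by
          rw [Multiset.eq_of_mem_replicate hx]; omega]
      rfl
    have hs : #f.support = 3 := by rw [← sum_cycleType, hc]; rfl
    refine ⟨hs, ?_⟩
    rw [hc, Multiset.card_singleton]
    omega
  · rintro ⟨hs, hc⟩
    obtain ⟨x, hx⟩ := Multiset.card_eq_one.1 (show Multiset.card f.cycleType = 1 by omega)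
    have hsum := sum_cycleType f
    rw [hx, Multiset.sum_singleton, hs] at hsum
    rw [parts_partition, hx, hs, hsum, hn, Nat.add_sub_cancel]

/-- With four moved points, the cycle number leaves two nontrivial cycles; each has length at least
2, so both are transpositions. -/
theorem parts_eq_iff_support_four {X : Type} [Fintype X] [DecidableEq X] {n : ℕ}
    (hn : Fintype.card X = n + 4) (f : Perm X) :
    f.partition.parts = {2, 2} + Multiset.replicate n 1 ↔
      #f.support = 4 ∧ f.numCycles + 2 = n + 4 := by
  have hle : #f.support ≤ Fintype.card X := card_le_univ _
  rw [numCycles_eq_card_cycleType]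
  constructor
  · intro h
    have hc : f.cycleType = {2, 2} := by
      rw [← filter_parts_partition_eq_cycleType, h, Multiset.filter_add,
        Multiset.filter_eq_nil (s := Multiset.replicate n 1) |>.2 fun x hx => by
          rw [Multiset.eq_of_mem_replicate hx]; omega]
      rfl
    have hs : #f.support = 4 := by rw [← sum_cycleType, hc]; rfl
    refine ⟨hs, ?_⟩
    rw [hc, Multiset.card_pair]
    omega
  · rintro ⟨hs, hc⟩
    obtain ⟨x, y, hx⟩ := Multiset.card_eq_two.1 (show Multiset.card f.cycleType = 2 by omega)
    have hsum := sum_cycleType f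
    have h2 := fun z (hz : z ∈ f.cycleType) => two_le_of_mem_cycleType hz
    rw [hx] at h2
    have hx2 := h2 x (by simp)
    have hy2 := h2 y (by simp)
    rw [hx, Multiset.sum_pair, hs] at hsum
    obtain rfl : x = 2 := by omega
    obtain rfl : y = 2 := by omega
    rw [parts_partition, hx, hs, hn, Nat.add_sub_cancel]

/-- With an empty second cycle, joining just means that the product with one full rotation is again
a full cycle, which is the condition for a rooted dipole. -/
theorem card_joiningPerms_zero_right (n k : ℕ) (hn : 0 < n) :
    #(joiningPerms n 0 k 2) = Nat.card {ρ : Perm (Fin n) //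
      (#ρ.support = k ∧ ρ.numCycles + 2 = n) ∧ (finRotate n * ρ).IsCycleOn Set.univ} := by
  have : Nonempty (Fin n) := ⟨⟨0, hn⟩⟩
  rw [← Fintype.card_coe, ← Nat.card_eq_fintype_card]
  let e : Fin n ⊕ Fin 0 ≃ Fin n := sumEmpty _ _
  refine Nat.card_congr (e.permCongr.subtypeEquiv fun ρ => ?_)
  have h1 : finRotate n * e.permCongr ρ =
      e.permCongr (Perm.sumCongr (finRotate n) (finRotate 0) * ρ) := by
    ext x
    obtain ⟨z, rfl⟩ := e.surjective x
    simp only [Perm.mul_apply, permCongr_apply, symm_apply_apply]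
    rcases ρ z with w | w
    · rfl
    · exact w.elim0
  have h2 : (e.permCongr ρ).support = ρ.support.map e.toEmbedding := by
    ext x
    obtain ⟨z, rfl⟩ := e.surjective x
    simp
  rw [isCycleOn_univ_iff, h1, numCycles_permCongr, numCycles_permCongr, h2, card_map,
    joiningPerms, mem_filter, and_assoc]
  simp

theorem psi_eq_card {lam : Multiset ℕ} {n : ℕ} (h : lam.sum = n) :
    psi lam = Nat.card {D : RootedDipole n // D.halfFaceDegrees = lam} := by
  subst h; rfl

theorem psiThree_eq (a : ℕ) : psiThree a = (a + 1).choose 3 := by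
  rw [psiThree]
  split_ifs with ha
  · rw [Nat.choose_eq_zero_of_lt (by omega)]
  · have hsum : (({3} : Multiset ℕ) + Multiset.replicate (a - 2) 1).sum = a + 1 := by
      simp; omega
    have h : ∀ ρ : Perm (Fin (a + 1)), ρ.partition.parts = {3} + Multiset.replicate (a - 2) 1 ↔
        #ρ.support = 3 ∧ ρ.numCycles + 2 = a + 1 := fun ρ => by
      rw [parts_eq_iff_support_three (n := a - 2) (by rw [Fintype.card_fin]; omega),
        show a - 2 + 3 = a + 1 by omega]
    rw [psi_eq_card hsum, card_rootedDipole isCycleOn_finRotate 0]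
    simp_rw [h]
    rw [← card_joiningPerms_zero_right _ _ a.succ_pos, card_joiningPerms _ _ _ _ (by omega)]
    simp [Finset.Nat.antidiagonal_succ, chooseMeeting, card_joiningPerms_three_zero]

theorem psiTwoTwo_eq (a : ℕ) : psiTwoTwo a = (a + 1).choose 4 := by
  rw [psiTwoTwo]
  split_ifs with ha
  · rw [Nat.choose_eq_zero_of_lt (by omega)]
  · have hsum : (({2, 2} : Multiset ℕ) + Multiset.replicate (a - 3) 1).sum = a + 1 := by
      simp; omega
    have h : ∀ ρ : Perm (Fin (a + 1)), ρ.partition.parts = {2, 2} + Multiset.replicate (a - 3) 1 ↔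
        #ρ.support = 4 ∧ ρ.numCycles + 2 = a + 1 := fun ρ => by
      rw [parts_eq_iff_support_four (n := a - 3) (by rw [Fintype.card_fin]; omega),
        show a - 3 + 4 = a + 1 by omega]
    rw [psi_eq_card hsum, card_rootedDipole isCycleOn_finRotate 0]
    simp_rw [h]
    rw [← card_joiningPerms_zero_right _ _ a.succ_pos, card_joiningPerms _ _ _ _ (by omega)]
    simp [Finset.Nat.antidiagonal_succ, chooseMeeting, card_joiningPerms_four_zero]

/-! ### Dipoles without `c`- and `d`-edges -/

namespace LabelledBirootedDipole

variable {E : Type} [Fintype E] (D : LabelledBirootedDipole E)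

theorem orbitIndex_secondary_pos {p : Perm E} (hp : p.IsCycleOn Set.univ) :
    0 < orbitIndex p D.root D.secondary := by
  refine Nat.pos_of_ne_zero fun h => D.secondary_ne ?_
  rw [← orbitIndex_self hp D.root] at h
  exact orbitIndex_injective hp D.root h

theorem inRegion1_or_inRegion2 {e : E} (h₁ : e ≠ D.root) (h₂ : e ≠ D.secondary) :
    D.InRegion1 e ∨ D.InRegion2 e := by
  have hp := D.rotRoot_cyclic
  have h₁' : orbitIndex D.rotRoot D.root e ≠ 0 := fun h =>
    h₁ (orbitIndex_injective hp D.root (h.trans (orbitIndex_self hp D.root).symm))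
  have h₂' := (orbitIndex_injective hp D.root).ne h₂
  unfold InRegion1 InRegion2
  omega

theorem not_inRegion4_iff :
    (∀ e, ¬ D.InRegion4 e) ↔ D.rotNonroot D.secondary = D.root := by
  have hp := D.rotNonroot_cyclic
  obtain ⟨hlt, hs⟩ := orbitIndex_spec hp D.root D.secondary
  have hnext : (D.rotNonroot ^ (orbitIndex D.rotNonroot D.root D.secondary + 1)) D.root =
      D.rotNonroot D.secondary := by rw [pow_succ', Perm.mul_apply, hs]
  constructor
  · intro h
    by_contra hne
    refine h (D.rotNonroot D.secondary) ?_
    unfold InRegion4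
    rcases Nat.lt_or_ge (orbitIndex D.rotNonroot D.root D.secondary + 1) (Fintype.card E)
      with h' | h'
    · rw [← hnext, orbitIndex_pow hp D.root h']
      exact Nat.lt_succ_self _
    · refine absurd ?_ hne
      rw [← hnext, show orbitIndex D.rotNonroot D.root D.secondary + 1 = Fintype.card E by omega]
      exact (pow_apply_eq_iff_modEq hp D.root _ 0).2 (by simp [Nat.ModEq])
  · intro h e he
    have he' := (orbitIndex_spec hp D.root e).1
    have hmod := (pow_apply_eq_iff_modEq hp D.root _ 0).1 (hnext.trans h)
    have hle := Nat.le_of_dvd (Nat.succ_pos _) ((Nat.modEq_zero_iff_dvd).1 hmod)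
    unfold InRegion4 at he
    omega

/-- The `c`- and `d`-edges together are all the edges in Region 4, since every edge there lies in
Region 1 or 2 at the root vertex. -/
theorem numC_eq_zero_and_numD_eq_zero_iff :
    D.numC = 0 ∧ D.numD = 0 ↔ D.rotNonroot D.secondary = D.root := by
  rw [← not_inRegion4_iff, numC, numD, Finite.card_eq_zero_iff, Finite.card_eq_zero_iff,
    isEmpty_subtype, isEmpty_subtype]
  constructor
  · rintro ⟨hc, hd⟩ e he
    have hp := D.rotNonroot_cyclic
    have h₁ : e ≠ D.root := by
      rintro rfl
      unfold InRegion4 at he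
      rw [orbitIndex_self hp] at he
      omega
    have h₂ : e ≠ D.secondary := by
      rintro rfl
      exact lt_irrefl _ he
    rcases D.inRegion1_or_inRegion2 h₁ h₂ with h | h
    · exact hd e ⟨h, he⟩
    · exact hc e ⟨h, he⟩
  · exact fun h => ⟨fun e he => h e he.2, fun e he => h e he.2⟩

variable {D} in
theorem inRegion3_of_ne (h : D.rotNonroot D.secondary = D.root) {e : E} (h₁ : e ≠ D.root)
    (h₂ : e ≠ D.secondary) : D.InRegion3 e := by
  have hp := D.rotNonroot_cyclic
  have h₁' : orbitIndex D.rotNonroot D.root e ≠ 0 := fun h =>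
    h₁ (orbitIndex_injective hp D.root (h.trans (orbitIndex_self hp D.root).symm))
  have h₂' := (orbitIndex_injective hp D.root).ne h₂
  have h4 := D.not_inRegion4_iff.2 h e
  unfold InRegion4 at h4
  unfold InRegion3
  omega

/-- All other edges lie in Region 3, so the `a`-edges are those after the secondary edge at the root
vertex. -/
theorem numA_add_orbitIndex (h : D.rotNonroot D.secondary = D.root) :
    D.numA + orbitIndex D.rotRoot D.root D.secondary + 1 = Fintype.card E := by
  have hp := D.rotRoot_cyclic
  have hlt := (orbitIndex_spec hp D.root D.secondary).1
  have hcard : D.numA = Nat.card {i : Fin (Fintype.card E) //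
      i ∈ Ioi (orbitEquiv hp D.root D.secondary)} := by
    refine Nat.card_congr ((orbitEquiv hp D.root).subtypeEquiv fun e => ?_)
    rw [mem_Ioi, Fin.lt_def]
    refine ⟨fun he => he.1, fun he => ⟨he, inRegion3_of_ne h ?_ ?_⟩⟩
    · rintro rfl
      have h0 := orbitIndex_self hp D.root
      change _ < orbitIndex D.rotRoot D.root D.root at he
      omega
    · rintro rfl
      exact lt_irrefl _ he
  rw [hcard, Nat.card_eq_fintype_card, Fintype.card_coe, Fin.card_Ioi]
  change Fintype.card E - 1 - orbitIndex D.rotRoot D.root D.secondary + _ + 1 = _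
  omega

theorem numB_add_one (h : D.rotNonroot D.secondary = D.root) :
    D.numB + 1 = orbitIndex D.rotRoot D.root D.secondary := by
  have hp := D.rotRoot_cyclic
  have hpos := D.orbitIndex_secondary_pos hp
  have h0 := orbitIndex_self hp D.root
  have hcard : D.numB = Nat.card {i : Fin (Fintype.card E) //
      i ∈ Ioo (orbitEquiv hp D.root D.root) (orbitEquiv hp D.root D.secondary)} := by
    refine Nat.card_congr ((orbitEquiv hp D.root).subtypeEquiv fun e => ?_)
    rw [mem_Ioo, Fin.lt_def, Fin.lt_def]
    change _ ↔ orbitIndex D.rotRoot D.root D.root < orbitIndex D.rotRoot D.root e ∧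
      orbitIndex D.rotRoot D.root e < orbitIndex D.rotRoot D.root D.secondary
    rw [h0]
    refine ⟨fun he => he.1, fun he => ⟨he, inRegion3_of_ne h ?_ ?_⟩⟩
    · rintro rfl
      omega
    · rintro rfl
      omega
  rw [hcard, Nat.card_eq_fintype_card, Fintype.card_coe, Fin.card_Ioo]
  change orbitIndex D.rotRoot D.root D.secondary - orbitIndex D.rotRoot D.root D.root - 1 + 1 = _
  omega

theorem eq_of {E : Type} {D D' : LabelledBirootedDipole E} (h : D.toLabelledDipole = D'.toLabelledDipole)
    (hs : D.secondary = D'.secondary) : D = D' := by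
  cases D; cases D'; simp_all

end LabelledBirootedDipole

open LabelledBirootedDipole in
/-- Dipoles without `c`- and `d`-edges are counted by their face permutations. -/
theorem nonempty_equiv_abcdDipole {a b g : ℕ} (hg : 0 < g) {σ : Perm (Fin (a + b + 2))}
    (hσ : σ.IsCycleOn Set.univ) {r s : Fin (a + b + 2)} (hs : orbitIndex σ r s = b + 1) :
    Nonempty ({ρ : Perm (Fin (a + b + 2)) // ρ.numCycles + 2 * g = a + b + 2 ∧
      (σ * ρ).IsCycleOn Set.univ ∧ (σ * ρ) r = s} ≃ ABCDDipole a b 0 0 g) := by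
  have hne : s ≠ r := by
    rintro rfl
    rw [orbitIndex_self hσ] at hs
    omega
  let mk : {ρ : Perm (Fin (a + b + 2)) // ρ.numCycles + 2 * g = a + b + 2 ∧
      (σ * ρ).IsCycleOn Set.univ ∧ (σ * ρ) r = s} → LabelledBirootedDipole (Fin (a + b + 2)) :=
    fun ρ => ⟨LabelledDipole.ofFaceStep hσ ρ.2.2.1 r, s, hne⟩
  have hmk : ∀ ρ, (mk ρ).rotNonroot (mk ρ).secondary = (mk ρ).root := fun ρ =>
    Perm.inv_eq_iff_eq.2 ρ.2.2.2.symm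
  -- As `g` is positive, the truncated subtraction cannot have been cut off at 0.
  have hiff : ∀ {n : ℕ} (D : LabelledBirootedDipole (Fin n)),
      (n - Multiset.card D.toLabelledDipole.halfFaceDegrees = 2 * g ↔
        D.faceStep.numCycles + 2 * g = n) := by
    intro n D
    rw [LabelledDipole.halfFaceDegrees, card_parts_partition]
    omega
  refine ⟨Equiv.ofBijective
    (fun ρ => (⟨⟨a + b + 2, Quotient.mk _ (mk ρ)⟩, by
      have hA := (mk ρ).numA_add_orbitIndex (hmk ρ)
      have hB := (mk ρ).numB_add_one (hmk ρ)
      have hCD := (mk ρ).numC_eq_zero_and_numD_eq_zero_iff.2 (hmk ρ)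
      have hs' : orbitIndex (mk ρ).rotRoot (mk ρ).root (mk ρ).secondary = b + 1 := hs
      rw [Fintype.card_fin] at hA
      refine ⟨show (mk ρ).numA = a by omega, show (mk ρ).numB = b by omega, hCD.1, hCD.2,
        (hiff (mk ρ)).2 ?_⟩
      rw [show (mk ρ).faceStep = ρ.1 from
        LabelledDipole.faceStep_ofFaceStep hσ ρ.2.2.1 r]
      exact ρ.2.1⟩ : ABCDDipole a b 0 0 g)) ⟨?_, ?_⟩⟩
  · rintro ρ ρ' h
    have h' := eq_of_heq (Sigma.mk.inj (congrArg Subtype.val h)).2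
    obtain ⟨π, hπ⟩ := Quotient.exact h'
    have hπ := congrArg LabelledBirootedDipole.toLabelledDipole hπ
    have hπ1 : π = 1 := eq_one_of_conj_eq hσ r (congrArg LabelledDipole.rotRoot hπ)
      (congrArg LabelledDipole.root hπ)
    have := congrArg LabelledDipole.faceStep hπ
    rw [LabelledBirootedDipole.relabel, LabelledDipole.faceStep_relabel,
      LabelledDipole.faceStep_ofFaceStep, LabelledDipole.faceStep_ofFaceStep, hπ1] at this
    exact Subtype.ext (by simpa using this)
  · rintro ⟨⟨n, ⟨D⟩⟩, hα, hβ, hγ, hδ, hG⟩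
    have hα : D.numA = a := hα
    have hβ : D.numB = b := hβ
    have hroot := D.numC_eq_zero_and_numD_eq_zero_iff.1 ⟨hγ, hδ⟩
    have hA := D.numA_add_orbitIndex hroot
    have hB := D.numB_add_one hroot
    rw [Fintype.card_fin] at hA
    -- The edge types determine the number of edges: the root and secondary edges account for the 2.
    obtain rfl : n = a + b + 2 := by omega
    have hG := (hiff D).1 hG
    let π := orbitPerm D.rotRoot_cyclic hσ D.root r
    have h₁ : (D.relabel π).rotRoot = σ := orbitPerm_conj _ _ _ _
    have h₃ : (D.relabel π).root = r := orbitPerm_root _ _ _ _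
    have h₄ : (D.relabel π).secondary = s := by
      refine orbitIndex_injective hσ r ?_
      have h := orbitIndex_conj D.rotRoot π D.root D.secondary
      have h' : orbitIndex σ r (π D.secondary) =
          orbitIndex (π * D.rotRoot * π⁻¹) (π D.root) (π D.secondary) :=
        congrArg₂ (fun p x => orbitIndex p x (π D.secondary)) h₁.symm h₃.symm
      exact (h'.trans (h.trans (by omega))).trans hs.symm
    have hc := isCycleOn_rotRoot_mul_faceStep (D.relabel π).toLabelledDipole
    have he := (D.relabel π).ofFaceStep_faceStep hc
    have hm := (D.relabel π).rotRoot_mul_faceStep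
    rw [h₁] at hm
    have hc' := hc
    rw [h₁] at hc'
    refine ⟨⟨(D.relabel π).faceStep, ?_, hc', ?_⟩, Subtype.ext ?_⟩
    · rw [show (D.relabel π).faceStep = π * D.faceStep * π⁻¹ from
        D.toLabelledDipole.faceStep_relabel π]
      have : π * D.faceStep * π⁻¹ = π.permCongr D.faceStep := by
        ext x; simp
      rw [this, numCycles_permCongr, hG]
    · rw [hm, Perm.inv_eq_iff_eq, ← h₄, ← h₃]
      change π D.root = (π * D.rotNonroot * π⁻¹) (π D.secondary)
      simp [hroot]
    · refine Sigma.ext rfl (heq_of_eq ?_)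
      refine (Quotient.sound (s := LabelledBirootedDipole.setoid) (a := D) ⟨π, ?_⟩).symm
      refine LabelledBirootedDipole.eq_of (LabelledDipole.eq_of h₁ ?_ h₃) h₄
      have := (congrArg LabelledDipole.rotNonroot he).symm
      simpa [LabelledDipole.ofFaceStep, h₁, mk] using this

/-! ### A normal form for the root circulation, and removal of the root edge. -/

section Canonical

variable {a b : ℕ}

/-- The circulation `none, inr 0, …, inr b, inl 0, …, inl a`. -/
def bipartiteRotation (a b : ℕ) : Perm (Option (Fin (a + 1) ⊕ Fin (b + 1))) :=
  swap none (some (Sum.inl 0)) *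
    optionCongr (Perm.sumCongr (finRotate (a + 1)) (finRotate (b + 1))) *
    swap none (some (Sum.inr (Fin.last b)))

theorem bipartiteRotation_pow_inr (i : ℕ) (hi : i < b + 1) :
    (bipartiteRotation a b ^ (i + 1)) none = some (Sum.inr ⟨i, hi⟩) := by
  induction i with
  | zero => simp [bipartiteRotation, finRotate_last, -finRotate_apply, swap_apply_of_ne_of_ne]
  | succ i ih =>
    rw [pow_succ', Perm.mul_apply, ih (by omega)]
    have h1 : (⟨i, by omega⟩ : Fin (b + 1)) ≠ Fin.last b := fun h => by
      have := congrArg Fin.val h; simp at this; omega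
    have h2 : finRotate (b + 1) ⟨i, by omega⟩ = ⟨i + 1, hi⟩ :=
      Fin.ext (coe_finRotate_of_ne_last h1)
    simp [bipartiteRotation, h2, -finRotate_apply, swap_apply_of_ne_of_ne, h1]

theorem bipartiteRotation_pow_inl (i : ℕ) (hi : i < a + 1) :
    (bipartiteRotation a b ^ (b + 2 + i)) none = some (Sum.inl ⟨i, hi⟩) := by
  induction i with
  | zero =>
    rw [add_zero, pow_succ', Perm.mul_apply, bipartiteRotation_pow_inr b (by omega)]
    have : (⟨b, by omega⟩ : Fin (b + 1)) = Fin.last b := rfl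
    simp [bipartiteRotation, this]
  | succ i ih =>
    rw [← add_assoc, pow_succ', Perm.mul_apply, ih (by omega)]
    have h1 : (⟨i, by omega⟩ : Fin (a + 1)) ≠ Fin.last a := fun h => by
      have := congrArg Fin.val h; simp at this; omega
    have h2 : finRotate (a + 1) ⟨i, by omega⟩ = ⟨i + 1, hi⟩ :=
      Fin.ext (coe_finRotate_of_ne_last h1)
    simp [bipartiteRotation, h2, -finRotate_apply, swap_apply_of_ne_of_ne, Fin.ext_iff]

theorem isCycleOn_bipartiteRotation : (bipartiteRotation a b).IsCycleOn Set.univ := by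
  have h : ∀ x, (bipartiteRotation a b).SameCycle none x := by
    rintro (_ | x | x)
    · exact SameCycle.refl _ _
    · exact ⟨(b + 2 + x.val : ℕ), by rw [zpow_natCast]; exact bipartiteRotation_pow_inl x x.isLt⟩
    · exact ⟨(x.val + 1 : ℕ), by rw [zpow_natCast]; exact bipartiteRotation_pow_inr x x.isLt⟩
  exact ⟨by simp, fun x _ y _ => (h x).symm.trans (h y)⟩

theorem orbitIndex_bipartiteRotation :
    orbitIndex (bipartiteRotation a b) none (some (Sum.inl 0)) = b + 2 := by
  have := orbitIndex_pow (isCycleOn_bipartiteRotation (a := a) (b := b)) none (i := b + 2)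
    (by simp; omega)
  rwa [show b + 2 = b + 2 + 0 from rfl, bipartiteRotation_pow_inl 0 (by omega)] at this

/-- The permutation with cycles those of `ρ`, and `none` inserted before `inr b`. -/
def insertRoot (ρ : Perm (Fin (a + 1) ⊕ Fin (b + 1))) : Perm (Option (Fin (a + 1) ⊕ Fin (b + 1))) :=
  swap none (some (Sum.inr (Fin.last b))) * optionCongr ρ

/-- The last factor of the circulation cancels the swap that inserts the root. In the product,
`none` is then inserted just before `inl 0`, which leaves the cycle number unchanged. -/
theorem bipartiteRotation_mul (ρ : Perm (Fin (a + 1) ⊕ Fin (b + 1))) :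
    bipartiteRotation a b * insertRoot ρ =
      swap none (some (Sum.inl 0)) *
        optionCongr (Perm.sumCongr (finRotate (a + 1)) (finRotate (b + 1)) * ρ) := by
  have h : optionCongr (Perm.sumCongr (finRotate (a + 1)) (finRotate (b + 1)) * ρ) =
      optionCongr (Perm.sumCongr (finRotate (a + 1)) (finRotate (b + 1))) * optionCongr ρ := by
    ext x
    cases x <;> simp
  rw [h, insertRoot, bipartiteRotation, mul_assoc, mul_assoc, ← mul_assoc (swap none _) (swap none _),
    swap_mul_self, one_mul]

theorem card_faceStep_eq (c : ℕ) :
    Nat.card {ρ : Perm (Option (Fin (a + 1) ⊕ Fin (b + 1))) // ρ.numCycles = c ∧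
      (bipartiteRotation a b * ρ).IsCycleOn Set.univ ∧
      (bipartiteRotation a b * ρ) none = some (Sum.inl 0)} =
    Nat.card {ρ : Perm (Fin (a + 1) ⊕ Fin (b + 1)) // ρ.numCycles = c ∧
      (Perm.sumCongr (finRotate (a + 1)) (finRotate (b + 1)) * ρ).numCycles = 1} := by
  symm
  have hiff : ∀ ρ : Perm (Fin (a + 1) ⊕ Fin (b + 1)),
      (ρ.numCycles = c ∧
        (Perm.sumCongr (finRotate (a + 1)) (finRotate (b + 1)) * ρ).numCycles = 1) ↔
      ((insertRoot ρ).numCycles = c ∧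
      (bipartiteRotation a b *
insertRoot ρ).IsCycleOn Set.univ ∧
      (bipartiteRotation a b *
        insertRoot ρ) none = some (Sum.inl 0)) := by
    intro ρ
    rw [isCycleOn_univ_iff, bipartiteRotation_mul, insertRoot, numCycles_swap_none_mul,
      numCycles_swap_none_mul]
    simp
  refine Nat.card_eq_of_bijective (fun ρ => ⟨_, (hiff ρ.1).1 ρ.2⟩) ⟨?_, ?_⟩
  · rintro ⟨ρ, _⟩ ⟨ρ', _⟩ h
    exact Subtype.ext (optionCongr_injective (mul_left_cancel (congrArg Subtype.val h)))
  · rintro ⟨ρ, hρ⟩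
    -- The circulation takes `inr b` to `inl 0`, so the condition at `none` says where `ρ` sends
    -- `none`.
    have hnone : ρ none = some (Sum.inr (Fin.last b)) := by
      apply (bipartiteRotation a b).injective
      rw [← Perm.mul_apply, hρ.2.2]
      simp [bipartiteRotation]
    have hdec : insertRoot (removeNone ρ) = ρ := by
      rw [insertRoot, ← hnone]
      exact Perm.decomposeOption.left_inv ρ
    exact ⟨⟨removeNone ρ, (hiff _).2 (by rwa [hdec])⟩, Subtype.ext hdec⟩

end Canonical

theorem permCongr_mul_perm {X Y : Type} (e : X ≃ Y) (f g : Perm X) :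
    e.permCongr (f * g) = e.permCongr f * e.permCongr g := by
  ext x; simp [permCongr_apply]

theorem orbitIndex_permCongr {X Y : Type} (e : X ≃ Y) (p : Perm X) (x y : X) :
    orbitIndex (e.permCongr p) (e x) (e y) = orbitIndex p x y := by
  have h : ∀ i : ℕ, (e.permCongr p ^ i) (e x) = e ((p ^ i) x) := by
    intro i
    induction i with
    | zero => rfl
    | succ i ih => rw [pow_succ', Perm.mul_apply, ih, permCongr_apply, symm_apply_apply,
        pow_succ', Perm.mul_apply]
  simp [orbitIndex, h]

theorem card_abcdDipole_eq_card_perm (a b g : ℕ) (hg : 0 < g) :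
    Finite (ABCDDipole a (b + 1) 0 0 g) ∧ Nat.card (ABCDDipole a (b + 1) 0 0 g) =
      #{ρ : Perm (Fin (a + 1) ⊕ Fin (b + 1)) | ρ.numCycles + 2 * g = a + b + 3 ∧
        (Perm.sumCongr (finRotate (a + 1)) (finRotate (b + 1)) * ρ).numCycles = 1} := by
  have hN : Fintype.card (Option (Fin (a + 1) ⊕ Fin (b + 1))) = a + (b + 1) + 2 := by
    simp; omega
  let e : Option (Fin (a + 1) ⊕ Fin (b + 1)) ≃ Fin (a + (b + 1) + 2) :=
    Fintype.equivFinOfCardEq hN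
  have : Nonempty (Fin (a + (b + 1) + 2)) := ⟨0⟩
  have hσ : (e.permCongr (bipartiteRotation a b)).IsCycleOn Set.univ := by
    rw [isCycleOn_univ_iff, numCycles_permCongr, ← isCycleOn_univ_iff]
    exact isCycleOn_bipartiteRotation
  obtain ⟨f⟩ := nonempty_equiv_abcdDipole hg hσ (r := e none) (s := e (some (Sum.inl 0)))
    ((orbitIndex_permCongr e _ _ _).trans orbitIndex_bipartiteRotation)
  refine ⟨Finite.of_equiv _ f, ?_⟩
  rw [← Nat.card_congr f]
  have h1 : Nat.card {ρ : Perm (Option (Fin (a + 1) ⊕ Fin (b + 1))) //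
      ρ.numCycles + 2 * g = a + (b + 1) + 2 ∧
      (bipartiteRotation a b * ρ).IsCycleOn Set.univ ∧
      (bipartiteRotation a b * ρ) none = some (Sum.inl 0)} = _ :=
    Nat.card_congr (e.permCongr.subtypeEquiv (q := fun ρ => ρ.numCycles + 2 * g = a + (b + 1) + 2 ∧
      (e.permCongr (bipartiteRotation a b) * ρ).IsCycleOn Set.univ ∧
      (e.permCongr (bipartiteRotation a b) * ρ) (e none) = e (some (Sum.inl 0))) fun ρ => by
      rw [← permCongr_mul_perm, isCycleOn_univ_iff, isCycleOn_univ_iff, numCycles_permCongr,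
        numCycles_permCongr]
      simp)
  rw [← h1]
  -- `card_faceStep_eq` needs an explicit cycle number; if the subtraction would truncate, both
  -- sides are 0.
  by_cases hle : 2 * g ≤ a + b + 3
  · have h2 : ∀ c, c + 2 * g = a + b + 3 ↔ c = a + b + 3 - 2 * g := fun c => by omega
    simp_rw [show a + (b + 1) + 2 = a + b + 3 by omega, h2]
    rw [card_faceStep_eq, Nat.card_eq_fintype_card, Fintype.card_subtype]
  · have h2 : ∀ c, ¬ (c + 2 * g = a + b + 3) := fun c => by omega
    simp [show a + (b + 1) + 2 = a + b + 3 by omega, h2]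

/-! ### The generating series -/

theorem xyExp_inj {i j i' j' : ℕ} : xyExp i j = xyExp i' j' ↔ i = i' ∧ j = j' := by
  constructor
  · intro h
    have h0 := DFunLike.congr_fun h 0
    have h1 := DFunLike.congr_fun h 1
    simp [xyExp] at h0 h1
    exact ⟨h0, h1⟩
  · rintro ⟨rfl, rfl⟩; rfl

theorem eval_one_faceMonomial {n : ℕ} (D : BirootedDipole n) :
    MvPolynomial.eval (fun _ => (1 : ℚ)) (faceMonomial D) = 1 := by
  rw [faceMonomial, map_mul, MvPolynomial.eval_X, one_mul, map_multiset_prod, Multiset.map_map]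
  refine Multiset.prod_eq_one fun x hx => ?_
  obtain ⟨S, -, rfl⟩ := Multiset.mem_map.1 hx
  simp

theorem coeff_dipoleTerm {n : ℕ} (D : BirootedDipole n) (k i j : ℕ) :
    MvPowerSeries.coeff (xyExp (i + 1) j) (PowerSeries.coeff k (dipoleTerm D)) =
      if D.alpha = i ∧ D.beta = j ∧ D.twiceGenus = k then
        (((i + 1)! * j ! : ℚ)⁻¹ • faceMonomial D) else 0 := by
  classical
  rw [dipoleTerm, PowerSeries.coeff_monomial]
  by_cases hk : k = D.twiceGenus
  · rw [if_pos hk, MvPowerSeries.coeff_monomial]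
    by_cases hij : xyExp (i + 1) j = xyExp (D.alpha + 1) D.beta
    · obtain ⟨h1, h2⟩ := xyExp_inj.1 hij
      obtain rfl : i = D.alpha := by omega
      subst h2 hk
      simp
    · rw [if_neg hij, if_neg]
      rintro ⟨rfl, rfl, -⟩
      exact hij rfl
  · rw [if_neg hk, if_neg, map_zero]
    rintro ⟨-, -, rfl⟩
    exact hk rfl

theorem expCoeff_genusSeries (a b g : ℕ) (hfin : Finite (ABCDDipole a b 0 0 g)) :
    expCoeff (a + 1) b (forgetFaces (genusSeries g)) = Nat.card (ABCDDipole a b 0 0 g) := by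
  classical
  let S := {D : Σ n, BirootedDipole n // D.2.gamma = 0 ∧ D.2.delta = 0}
  let T : Set S := {D | D.1.2.alpha = a ∧ D.1.2.beta = b ∧ D.1.2.twiceGenus = 2 * g}
  let e : T ≃ ABCDDipole a b 0 0 g :=
    { toFun := fun D => ⟨D.1.1, D.2.1, D.2.2.1, D.1.2.1, D.1.2.2, D.2.2.2⟩
      invFun := fun D => ⟨⟨D.1, D.2.2.2.1, D.2.2.2.2.1⟩, D.2.1, D.2.2.1, D.2.2.2.2.2⟩
      left_inv := fun _ => rfl
      right_inv := fun _ => rfl }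
  have hT : T.Finite := by
    have : Finite T := Finite.of_equiv _ e.symm
    exact T.toFinite
  let c : S → FaceRing := fun D =>
    MvPowerSeries.coeff (xyExp (a + 1) b) (PowerSeries.coeff (2 * g) (dipoleTerm D.1.2))
  have hc : ∀ D : S, c D = if D ∈ T then
      (((a + 1)! * b ! : ℚ)⁻¹ • faceMonomial D.1.2) else 0 := fun D =>
    coeff_dipoleTerm D.1.2 (2 * g) a b
  have hcT : Function.support c ⊆ hT.toFinset := by
    intro D hD
    by_contra hn
    rw [Set.Finite.coe_toFinset] at hn
    exact hD ((hc D).trans (if_neg hn))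
  -- Finiteness of the set of dipoles enters here: with infinite support the `finsum` would take its
  -- default value 0.
  have hcoeff : MvPowerSeries.coeff (xyExp (a + 1) b) (genusSeries g) = ∑ D ∈ hT.toFinset, c D := by
    rw [← finsum_eq_sum_of_support_subset c hcT]
    exact congrArg (MvPowerSeries.coeff (xyExp (a + 1) b)) (PowerSeries.coeff_mk (2 * g) _)
  have hsum : MvPolynomial.eval (fun _ => (1 : ℚ)) (∑ D ∈ hT.toFinset, c D) =
      Nat.card T * ((a + 1)! * b ! : ℚ)⁻¹ := by
    rw [map_sum, Nat.card_eq_card_finite_toFinset hT, ← nsmul_eq_mul, ← sum_const]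
    refine sum_congr rfl fun D hD => ?_
    rw [hc, if_pos (hT.mem_toFinset.1 hD), MvPolynomial.smul_eval, eval_one_faceMonomial, mul_one]
  rw [expCoeff, forgetFaces, MvPowerSeries.coeff_map, hcoeff, hsum, Nat.card_congr e]
  have h1 : ((a + 1)! : ℚ) ≠ 0 := by exact_mod_cast (a + 1).factorial_ne_zero
  have h2 : (b ! : ℚ) ≠ 0 := by exact_mod_cast b.factorial_ne_zero
  field_simp

/-! ### Genus two -/

theorem card_perm_eq_sum_joiningPerms (m₁ m₂ : ℕ) :
    #{ρ : Perm (Fin m₁ ⊕ Fin m₂) | ρ.numCycles + 3 = m₁ + m₂ ∧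
        (Perm.sumCongr (finRotate m₁) (finRotate m₂) * ρ).numCycles = 1} =
      #(joiningPerms m₁ m₂ 4 3) + #(joiningPerms m₁ m₂ 5 3) + #(joiningPerms m₁ m₂ 6 3) := by
  have hmaps : ∀ ρ ∈ ({ρ : Perm (Fin m₁ ⊕ Fin m₂) | ρ.numCycles + 3 = m₁ + m₂ ∧
      (Perm.sumCongr (finRotate m₁) (finRotate m₂) * ρ).numCycles = 1} : Finset _),
      #ρ.support ∈ ({4, 5, 6} : Finset ℕ) := by
    intro ρ hρ
    have h := (mem_filter.1 hρ).2.1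
    have hle : #ρ.support ≤ m₁ + m₂ := by simpa using card_le_univ ρ.support
    rw [numCycles_eq_card_cycleType, Fintype.card_sum, Fintype.card_fin, Fintype.card_fin] at h
    -- With `c` nontrivial cycles the support has `c + 3` points. Then `2 * c ≤ c + 3` gives `c ≤
    -- 3`, and `c = 0` is impossible.
    have h2 : Multiset.card ρ.cycleType * 2 ≤ #ρ.support := by
      rw [← sum_cycleType, ← smul_eq_mul]
      exact Multiset.card_nsmul_le_sum fun x hx => two_le_of_mem_cycleType hx
    have h0 : Multiset.card ρ.cycleType = 0 → #ρ.support = 0 := by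
      rw [Multiset.card_eq_zero, ← sum_cycleType]
      intro h; rw [h]; rfl
    simp only [mem_insert, mem_singleton]
    omega
  rw [card_eq_sum_card_fiberwise hmaps]
  have hfib : ∀ k, #{ρ ∈ ({ρ : Perm (Fin m₁ ⊕ Fin m₂) | ρ.numCycles + 3 = m₁ + m₂ ∧
      (Perm.sumCongr (finRotate m₁) (finRotate m₂) * ρ).numCycles = 1} : Finset _) |
      #ρ.support = k} = #(joiningPerms m₁ m₂ k 3) := by
    intro k
    congr 1
    ext ρ
    simp only [joiningPerms, mem_filter, mem_univ, true_and]
    tauto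
  simp_rw [hfib]
  simp [add_assoc]

/-- Both cycles are nonempty, so `chooseMeeting` removes the two end terms of the antidiagonal; the
rest are read from the table. -/
theorem card_joiningPerms_four (a b : ℕ) : #(joiningPerms (a + 1) (b + 1) 4 3) =
    3 * (a + 1).choose 1 * (b + 1).choose 3 + 2 * (a + 1).choose 2 * (b + 1).choose 2 +
      3 * (a + 1).choose 3 * (b + 1).choose 1 := by
  rw [card_joiningPerms _ _ _ _ (by omega)]
  simp [Finset.Nat.antidiagonal_succ, chooseMeeting, card_joiningPerms_one_three,
    card_joiningPerms_two_two, card_joiningPerms_three_one]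
  ring

theorem card_joiningPerms_five (a b : ℕ) : #(joiningPerms (a + 1) (b + 1) 5 3) =
    8 * (a + 1).choose 1 * (b + 1).choose 4 + 6 * (a + 1).choose 2 * (b + 1).choose 3 +
      6 * (a + 1).choose 3 * (b + 1).choose 2 + 8 * (a + 1).choose 4 * (b + 1).choose 1 := by
  rw [card_joiningPerms _ _ _ _ (by omega)]
  simp [Finset.Nat.antidiagonal_succ, chooseMeeting, card_joiningPerms_one_four,
    card_joiningPerms_two_three, card_joiningPerms_three_two, card_joiningPerms_four_one]
  ring

theorem card_joiningPerms_six (a b : ℕ) : #(joiningPerms (a + 1) (b + 1) 6 3) =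
    5 * (a + 1).choose 1 * (b + 1).choose 5 + 4 * (a + 1).choose 2 * (b + 1).choose 4 +
      3 * (a + 1).choose 3 * (b + 1).choose 3 + 4 * (a + 1).choose 4 * (b + 1).choose 2 +
      5 * (a + 1).choose 5 * (b + 1).choose 1 := by
  rw [card_joiningPerms _ _ _ _ (by omega)]
  simp [Finset.Nat.antidiagonal_succ, chooseMeeting, card_joiningPerms_one_five,
    card_joiningPerms_two_four, card_joiningPerms_three_three, card_joiningPerms_four_two,
    card_joiningPerms_five_one]
  ring

theorem card_abcdDipole_two (a b : ℕ) (hb : 1 ≤ b) :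
    (Nat.card (ABCDDipole a b 0 0 2) : ℚ) =
      3 * (a + 1) * (b + 2).choose 5 + a * (a + 1) * (b + 2).choose 4
        + 2 * (a + 1) * (b + 1).choose 5 + a * (a + 1) * (b + 1).choose 4
        + (3 * (b + 2).choose 3 + ((a : ℚ) - 2) * b) * psiThree a
        + (4 * (b + 1).choose 2 + ((a : ℚ) - 3) * b) * psiTwoTwo a := by
  obtain ⟨b, rfl⟩ : ∃ b', b = b' + 1 := ⟨b - 1, by omega⟩
  have hcount : Nat.card (ABCDDipole a (b + 1) 0 0 2) = #(joiningPerms (a + 1) (b + 1) 4 3) +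
      #(joiningPerms (a + 1) (b + 1) 5 3) + #(joiningPerms (a + 1) (b + 1) 6 3) := by
    rw [(card_abcdDipole_eq_card_perm a b 2 two_pos).2, ← card_perm_eq_sum_joiningPerms]
    congr 1
    ext ρ
    simp only [mem_filter, mem_univ, true_and]
    refine and_congr_left fun _ => ?_
    omega
  have p : ∀ n k : ℕ, ((n + 1).choose (k + 1) : ℚ) = n.choose k + n.choose (k + 1) := fun n k => by
    exact_mod_cast Nat.choose_succ_succ n k
  have q : ∀ k : ℕ, ((a + 1).choose (k + 1) : ℚ) * (k + 1) = (a + 1).choose k * (a + 1 - k) := by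
    intro k
    have h := Nat.choose_succ_right_eq (a + 1) k
    rcases le_or_gt k (a + 1) with hk | hk
    · have h' : ((a + 1 - k : ℕ) : ℚ) = a + 1 - k := by push_cast [hk]; ring
      rw [← h']
      exact_mod_cast h
    · rw [Nat.choose_eq_zero_of_lt hk, Nat.choose_eq_zero_of_lt (n := a + 1) (by omega)]
      simp
  rw [hcount, card_joiningPerms_four, card_joiningPerms_five, card_joiningPerms_six, psiThree_eq,
    psiTwoTwo_eq]
  have h2 := q 1
  have h4 := q 3
  have h5 := q 4
  have hb1 : ((b + 1).choose 1 : ℚ) = b + 1 := by simp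
  have ha1 : ((a + 1).choose 1 : ℚ) = a + 1 := by simp
  push_cast
  rw [p (b + 1 + 1) 4, p (b + 1 + 1) 3, p (b + 1 + 1) 2, p (b + 1) 4, p (b + 1) 3, p (b + 1) 2,
    p (b + 1) 1, hb1, ha1]
  norm_num only [ha1, Nat.cast_ofNat, Nat.cast_one, Nat.reduceAdd] at h2 h4 h5 ⊢
  -- After Pascal's rule in `b`, the relations express `a (a + 1)`, `(a - 2) ψ_{(3,1^{a-2})}` and
  -- `(a - 3) ψ_{(2²,1^{a-3})}` as 2, 4 and 5 times the binomial coefficients of `a + 1` over 2, 4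
  -- and 5.
  linear_combination (2 * (b + 1).choose 4 + 3 * (b + 1).choose 3 + (b + 1).choose 2 : ℚ) * h2 +
    ((b : ℚ) + 1) * h4 + ((b : ℚ) + 1) * h5

theorem mainTheorem9 (a b : ℕ) (hb : 1 ≤ b) :
    (Nat.card (ABCDDipole a b 0 0 2) : ℚ) = expCoeff (a + 1) b (forgetFaces (genusSeries 2)) ∧
    expCoeff (a + 1) b (forgetFaces (genusSeries 2)) =
      3 * (a + 1) * (b + 2).choose 5 + a * (a + 1) * (b + 2).choose 4
        + 2 * (a + 1) * (b + 1).choose 5 + a * (a + 1) * (b + 1).choose 4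
        + (3 * (b + 2).choose 3 + ((a : ℚ) - 2) * b) * psiThree a
        + (4 * (b + 1).choose 2 + ((a : ℚ) - 3) * b) * psiTwoTwo a := by
  have hfin : Finite (ABCDDipole a b 0 0 2) := by
    obtain ⟨b, rfl⟩ : ∃ b', b = b' + 1 := ⟨b - 1, by omega⟩
    exact (card_abcdDipole_eq_card_perm a b 2 two_pos).1
  rw [expCoeff_genusSeries a b 2 hfin]
  exact ⟨rfl, card_abcdDipole_two a b hb⟩
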